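/- Let $d\ge 1$, let $P$ be a probability distribution on the unit sphere $\mathbb S^{d-1}\subset\mathbb R^d$, and write $\|F\|_{L_2}=(\mathbb E_{x\sim P}F(x)^2)^{1/2}$. Let $$f(x)=\sum_{s=1}^{r_\star}\alpha_s(\beta_s^\top x)^{p_s},\qquad |\alpha_s|\le 1,\quad \|(\beta_s^\top x)^{p_s}\|_{L_2}\le 1,$$ with $\beta_s\in\mathbb R^d$ and integers $p_s\ge 0$, and let $\epsilon,\delta\in(0,1)$. Let $v_j\sim N(0,I_d)$ and $b_j\sim N(0,1)$ ($j\le D$), $\tilde x_i\sim P$ ($i\le n_0$), $a_r\sim\mathrm{Unif}\{\pm1\}$ and $w_{0,r}\sim N(0,I_D)$ ($r\le m$) all be independent. Put $g(x)=(\mathbf 1\{v_j^\top x+b_j\ge 0\})_{j\le D}$, $\hat\Sigma=\frac1{n_0}\sum_{i\le n_0}g(\tilde x_i)g(\tilde x_i)^\top$ and, when $\hat\Sigma$ is nonsingular, $h(x)=\hat\Sigma^{-1/2}g(x)$. Suppose $$D\ \ge\ \frac{c\cdot 50^2\, r_\star^3\sum_{s=1}^{r_\star}\max(p_s,1)^5\,\|\beta_s\|_2^{2\lceil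 p_s/2\rceil}}{\epsilon^2\delta},\qquad m\ \ge\ \frac{54\,r_\star D\,(1+\log\frac8\delta)}{\epsilon^2}\log\frac1\epsilon,$$ where $c=8$; if all $p_s$ are even, $c=4$ is also allowed. Then there are weights $w_1^*,\dots,w_m^*\in\mathbb R^D$, which are functions of $(v_j,b_j)_j$, $(\tilde x_i)_i$ and $(a_r)_r$ only (not of the $w_{0,r}$), such that, with probability at least $1-\delta$, either $\hat\Sigma$ is singular (so that $h$ is not defined) or $$\Big\|\frac1{2\sqrt m}\sum_{r=1}^m a_r\,\mathbf 1\{w_{0,r}^\top h(x)\ge 0\}\,(w_r^{*\top}h(x))^2-f(x)\Big\|_{L_2}\ \le\ 7\,r_\star\,\epsilon .$$ -/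

import Mathlib

open MeasureTheory ProbabilityTheory
open scoped MatrixOrder ENNReal

noncomputable section

namespace QuadNTK

/-- The input space: the Euclidean unit sphere of `ℝ^d`. -/
abbrev Input (d : ℕ) : Type := Metric.sphere (0 : EuclideanSpace ℝ (Fin d)) 1

/-- The parameters `(v_j, b_j)`, `j < D`, of the `D` random features on `ℝ^d`. -/
abbrev FeatParam (d D : ℕ) : Type := Fin D → EuclideanSpace ℝ (Fin d) × ℝ

/-- The random indicator features `g(x)_j = 1{v_jᵀ x + b_j ≥ 0}`. -/
def feature {d D : ℕ} (θ : FeatParam d D) (x : Input d) : Fin D → ℝ :=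
  fun j => if 0 ≤ inner ℝ (θ j).1 (x : EuclideanSpace ℝ (Fin d)) + (θ j).2 then 1 else 0

/-- The estimated (uncentred) covariance `Σ̂ = (1/n₀) ∑ᵢ g(xᵢ) g(xᵢ)ᵀ` on an unlabeled sample. -/
def empCov {d D n₀ : ℕ} (θ : FeatParam d D) (X : Fin n₀ → Input d) :
    Matrix (Fin D) (Fin D) ℝ :=
  (n₀ : ℝ)⁻¹ • ∑ i, Matrix.vecMulVec (feature θ (X i)) (feature θ (X i))

/-- The whitened representation `h(x) = Σ̂^{-1/2} g(x)`. It is used only where `Σ̂` is positive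
definite; there `CFC.sqrt` is the positive definite square root, and `⁻¹` is its inverse. -/
def whitened {d D n₀ : ℕ} (θ : FeatParam d D) (X : Fin n₀ → Input d) (x : Input d) :
    EuclideanSpace ℝ (Fin D) :=
  WithLp.toLp 2 (((CFC.sqrt (empCov θ X))⁻¹).mulVec (feature θ x))

/-- The QuadNTK model on a representation `h ∈ ℝ^D`:
`(1/(2√m)) ∑ᵣ aᵣ 1{w₀,ᵣᵀ h ≥ 0} (wᵣᵀ h)²`. -/
def quadNTK {D m : ℕ} (a : Fin m → ℝ) (W₀ W : Fin m → EuclideanSpace ℝ (Fin D))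
    (h : EuclideanSpace ℝ (Fin D)) : ℝ :=
  1 / (2 * Real.sqrt m) *
    ∑ r, a r * (if 0 ≤ inner ℝ (W₀ r) h then 1 else 0) * (inner ℝ (W r) h) ^ 2

/-- The uniform distribution on `{1, -1}`. -/
def rademacher : Measure ℝ := (2⁻¹ : ℝ≥0∞) • (Measure.dirac 1 + Measure.dirac (-1))

/-- The polynomial `∑ₛ αₛ (βₛᵀ x)^{pₛ}`. -/
def target {d k : ℕ} (α : Fin k → ℝ) (β : Fin k → EuclideanSpace ℝ (Fin d)) (p : Fin k → ℕ)
    (x : Input d) : ℝ :=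
  ∑ s, α s * (inner ℝ (β s) (x : EuclideanSpace ℝ (Fin d))) ^ p s

/-- An outcome `(θ, X, a, W₀)` of all the randomness: feature parameters `θ = (v_j, b_j)_j`,
unlabeled sample `X`, signs `a`, and initialization `W₀`. -/
abbrev Outcome (d D n₀ m : ℕ) : Type :=
  FeatParam d D × (Fin n₀ → Input d) × (Fin m → ℝ) × (Fin m → EuclideanSpace ℝ (Fin D))

/-- The joint law of the randomness. Everything is independent, with `v_j ∼ N(0, I_d)`,
`b_j ∼ N(0, 1)`, `X_i ∼ P`, `a_r ∼ Unif{±1}` and `w_{0,r} ∼ N(0, I_D)`. -/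
def jointLaw {d : ℕ} (D n₀ m : ℕ) (P : Measure (Input d)) : Measure (Outcome d D n₀ m) :=
  (Measure.pi fun _ : Fin D =>
      (stdGaussian (EuclideanSpace ℝ (Fin d))).prod (gaussianReal 0 1)).prod
    ((Measure.pi fun _ : Fin n₀ => P).prod
      ((Measure.pi fun _ : Fin m => rademacher).prod
        (Measure.pi fun _ : Fin m => stdGaussian (EuclideanSpace ℝ (Fin D)))))

end QuadNTK

end

namespace QuadNTK

/-! With `z = βᵀx`, each monomial splits as `z ^ p = z ^ ⌈p/2⌉ * z ^ ⌊p/2⌋`. A quadratic neuron can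
produce such a product: if it reads `U + a V` with a random sign `a`, then `a (U + a V)²` has mean
`2 U V`, and the Gaussian gate contributes a further factor 1/2. It therefore suffices that both
factors be linear in the features `g(x)`. Whitening does no harm: the weights are `Σ̂^{1/2}` times a
coefficient vector for `g`, and `Σ̂^{1/2}` cancels against `h = Σ̂^{-1/2} g`.

Powers are linear read-outs in expectation (`exists_feature_coeff`). For unit `e`, `x`, the average
of `He_{n+1}(vᵀe) 1{vᵀx + b ≥ 0}` over `v` is `(eᵀx)^{n+1} He_n(-b) φ(b)`. Averaging over `b`
against a weight on which `He_n φ` is not small gives an exact representation whose coefficient has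
second moment `O(n³)`. Sampling `D` features with truncated coefficients (`exists_truncated_coeff`)
gives fourth-moment errors, which control the product of two read-outs in mean square
(`exists_readout_product`). Monomials with `‖β‖ ^ ⌈p/2⌉ ≤ ε` are below `ε` on the whole sphere and
are dropped.

The neurons are divided into balanced groups, one per monomial, scaled so that the mean over signs
and gates is exactly the sum of the products (`exists_group_scale`). The fluctuation around it has
mean square `O(1/m)` times fourth powers of the read-outs (`lintegral_quadNTK_sub_sq_le`).
Altogether (`lintegral_error_le`, `error_budget_le`) the mean square error is at most `δ (6kε)²`.
Markov's inequality gives error at most `6kε` outside probability `δ`, and the dropped monomials add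
at most `kε`. -/

open Polynomial

/-- The standard Gaussian measure on the line. -/
local notation "γ₁" => gaussianReal 0 1

/-! ### Hermite polynomials under the standard Gaussian -/

/-- The probabilists' Hermite polynomials, with real coefficients. -/
noncomputable def hermiteReal (n : ℕ) : ℝ[X] := (hermite n).map (Int.castRingHom ℝ)

theorem hermiteReal_zero : hermiteReal 0 = 1 := by simp [hermiteReal]

theorem hermiteReal_succ (n : ℕ) :
    hermiteReal (n + 1) = X * hermiteReal n - derivative (hermiteReal n) := by
  simp [hermiteReal, hermite_succ, Polynomial.derivative_map]

theorem derivative_hermiteReal_succ (n : ℕ) :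
    derivative (hermiteReal (n + 1)) = ((n : ℝ[X]) + 1) * hermiteReal n := by
  induction n with
  | zero => simp [hermiteReal_succ, hermiteReal_zero]
  | succ n ih =>
    rw [hermiteReal_succ (n + 1), derivative_sub, derivative_mul, derivative_X, one_mul, ih,
      derivative_mul, hermiteReal_succ n]
    simp
    ring

theorem hermiteReal_add_two (n : ℕ) :
    hermiteReal (n + 2) = X * hermiteReal (n + 1) - ((n : ℝ[X]) + 1) * hermiteReal n := by
  rw [hermiteReal_succ (n + 1), derivative_hermiteReal_succ]

theorem integrable_polynomial_gaussianReal (Q : ℝ[X]) :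
    Integrable (fun x => Q.eval x) γ₁ := by
  induction Q using Polynomial.induction_on' with
  | add P Q hP hQ => exact (hP.add hQ).congr (ae_of_all _ fun x => by simp)
  | monomial n a =>
    have h : Integrable (fun x : ℝ => ‖id x‖ ^ n) γ₁ :=
      (memLp_id_gaussianReal n).integrable_norm_pow'
    have h2 : Integrable (fun x : ℝ => x ^ n) γ₁ :=
      (integrable_norm_iff (by fun_prop)).1 (h.congr (ae_of_all _ fun x => by simp))
    exact (h2.const_mul a).congr (ae_of_all _ fun x => by simp)

theorem hasDerivAt_gaussianPDFReal (x : ℝ) :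
    HasDerivAt (gaussianPDFReal 0 1) (-x * gaussianPDFReal 0 1 x) x := by
  unfold gaussianPDFReal
  have h : HasDerivAt (fun x : ℝ => -(x - 0) ^ 2 / (2 * ((1 : NNReal) : ℝ))) (-x) x := by
    have := ((((hasDerivAt_id x).sub_const 0).pow 2).neg.div_const (2 * ((1 : NNReal) : ℝ)))
    refine this.congr_deriv ?_
    simp
    ring
  refine (h.exp.const_mul _).congr_deriv ?_
  ring

theorem integrable_mul_gaussianPDFReal {f : ℝ → ℝ} (hf : Integrable f γ₁) :
    Integrable (fun x => f x * gaussianPDFReal 0 1 x) := by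
  rw [gaussianReal_of_var_ne_zero _ one_ne_zero] at hf
  rw [integrable_withDensity_iff (measurable_gaussianPDF 0 1)
    (ae_of_all _ fun _ => gaussianPDF_lt_top)] at hf
  exact hf.congr (ae_of_all _ fun x => by simp only [toReal_gaussianPDF])

theorem integral_gaussianReal_eq (f : ℝ → ℝ) :
    ∫ x, f x ∂γ₁ = ∫ x, f x * gaussianPDFReal 0 1 x := by
  rw [integral_gaussianReal_eq_integral_smul one_ne_zero]
  simp [mul_comm]

theorem hasDerivAt_polynomial_mul_gaussianPDFReal (Q : ℝ[X]) (x : ℝ) :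
    HasDerivAt (fun x => Q.eval x * gaussianPDFReal 0 1 x)
      ((derivative Q - X * Q).eval x * gaussianPDFReal 0 1 x) x := by
  refine ((Q.hasDerivAt x).mul (hasDerivAt_gaussianPDFReal x)).congr_deriv ?_
  simp only [eval_sub, eval_mul, eval_X]
  ring

/-- Gaussian integration by parts for polynomials. -/
theorem integral_mul_polynomial_gaussianReal (Q : ℝ[X]) :
    ∫ x, x * Q.eval x ∂γ₁ = ∫ x, (derivative Q).eval x ∂γ₁ := by
  have h := integral_eq_zero_of_hasDerivAt_of_integrable
    (hasDerivAt_polynomial_mul_gaussianPDFReal Q)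
    (integrable_mul_gaussianPDFReal (integrable_polynomial_gaussianReal _))
    (integrable_mul_gaussianPDFReal (integrable_polynomial_gaussianReal _))
  rw [← integral_gaussianReal_eq] at h
  have h2 := integrable_polynomial_gaussianReal (X * Q)
  simp only [eval_sub] at h
  rw [integral_sub (integrable_polynomial_gaussianReal _) h2] at h
  simp only [eval_mul, eval_X] at h
  linarith

/-- Integration by parts: the operator `X - d/dx`, which raises `hermiteReal n`, is adjoint to the
derivative. -/
theorem integral_hermiteReal_succ_mul (n : ℕ) (Q : ℝ[X]) :
    ∫ x, (hermiteReal (n + 1) * Q).eval x ∂γ₁ = ∫ x, (hermiteReal n * derivative Q).eval x ∂γ₁ := by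
  have h := integral_mul_polynomial_gaussianReal (hermiteReal n * Q)
  have e1 : ∀ x : ℝ, (hermiteReal (n + 1) * Q).eval x = x * (hermiteReal n * Q).eval x
      - (derivative (hermiteReal n) * Q).eval x := by
    intro x; rw [hermiteReal_succ]; simp; ring
  have i1 : Integrable (fun x => x * (hermiteReal n * Q).eval x) γ₁ := by
    exact (integrable_polynomial_gaussianReal (X * (hermiteReal n * Q))).congr
      (ae_of_all _ fun x => by simp)
  simp_rw [e1]
  rw [integral_sub i1 (integrable_polynomial_gaussianReal _), h, derivative_mul]
  simp_rw [eval_add]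
  rw [integral_add (integrable_polynomial_gaussianReal _) (integrable_polynomial_gaussianReal _)]
  ring

theorem integral_hermiteReal_sq (n : ℕ) :
    ∫ x, (hermiteReal n).eval x ^ 2 ∂γ₁ = n.factorial := by
  induction n with
  | zero => simp [hermiteReal_zero]
  | succ n ih =>
    have h := integral_hermiteReal_succ_mul n (hermiteReal (n + 1))
    simp only [derivative_hermiteReal_succ] at h
    calc _ = ∫ x, (hermiteReal (n + 1) * hermiteReal (n + 1)).eval x ∂γ₁ := by
          simp [sq]
      _ = ∫ x, ((n : ℝ) + 1) * (hermiteReal n).eval x ^ 2 ∂γ₁ := by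
          rw [h]; congr 1; ext x; simp; ring
      _ = _ := by rw [integral_const_mul, ih, Nat.factorial_succ]; push_cast; ring

/-- The average of `He_n(A + c g)` over a standard Gaussian `g`. -/
theorem integral_hermiteReal_affine_add_two (A c : ℝ) (n : ℕ) :
    ∫ y, (hermiteReal (n + 2)).eval (A + c * y) ∂γ₁
      = A * ∫ y, (hermiteReal (n + 1)).eval (A + c * y) ∂γ₁
        - (1 - c ^ 2) * (n + 1) * ∫ y, (hermiteReal n).eval (A + c * y) ∂γ₁ := by
  have hint : ∀ Q : ℝ[X], Integrable (fun y => Q.eval (A + c * y)) γ₁ := fun Q => by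
    exact (integrable_polynomial_gaussianReal (Q.comp (C A + C c * X))).congr
      (ae_of_all _ fun x => by simp)
  have hs := integral_mul_polynomial_gaussianReal ((hermiteReal (n + 1)).comp (C A + C c * X))
  rw [derivative_comp, derivative_hermiteReal_succ] at hs
  have e1 : ∀ y : ℝ, (hermiteReal (n + 2)).eval (A + c * y)
      = A * (hermiteReal (n + 1)).eval (A + c * y)
        + c * (y * ((hermiteReal (n + 1)).comp (C A + C c * X)).eval y)
        - (n + 1) * (hermiteReal n).eval (A + c * y) := by
    intro y; rw [hermiteReal_add_two]; simp; ring
  have i1 : Integrable (fun y => y * ((hermiteReal (n + 1)).comp (C A + C c * X)).eval y) γ₁ := by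
    exact (integrable_polynomial_gaussianReal (X * (hermiteReal (n + 1)).comp (C A + C c * X))).congr
      (ae_of_all _ fun x => by simp)
  simp_rw [e1]
  have i2 := (hint (hermiteReal (n + 1))).const_mul A
  have i3 := i1.const_mul c
  have i4 := (hint (hermiteReal n)).const_mul ((n : ℝ) + 1)
  rw [integral_sub (by exact i2.add i3) i4, integral_add i2 i3, integral_const_mul, integral_const_mul,
    integral_const_mul, hs]
  have e2 : ∀ y : ℝ, eval y (derivative (C A + C c * X) *
      (((n : ℝ[X]) + 1) * hermiteReal n).comp (C A + C c * X))
      = c * (n + 1) * (hermiteReal n).eval (A + c * y) := by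
    intro y; simp; ring
  simp_rw [e2]
  rw [integral_const_mul]
  ring

/-- As `1 - c² = t²`, both sides obey the same three-term recurrence in `n`. Averaging out the
independent part of a correlated coordinate produces the `n`-th power of the correlation, which is
where the monomials come from. -/
theorem integral_hermiteReal_rotate {t c : ℝ} (h : t ^ 2 + c ^ 2 = 1) (y : ℝ) (n : ℕ) :
    ∫ y', (hermiteReal n).eval (t * y + c * y') ∂γ₁ = t ^ n * (hermiteReal n).eval y := by
  induction n using Nat.twoStepInduction with
  | zero => simp [hermiteReal_zero]
  | one =>
    simp only [hermiteReal_succ, hermiteReal_zero]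
    have i1 : Integrable (fun y' : ℝ => y') γ₁ :=
      (integrable_polynomial_gaussianReal X).congr (ae_of_all _ fun x => by simp)
    simp only [mul_one, derivative_one, sub_zero, eval_X, pow_one]
    rw [integral_add (integrable_const _) (i1.const_mul _), integral_const_mul c,
      integral_id_gaussianReal]
    simp
  | more n h0 h1 =>
    rw [integral_hermiteReal_affine_add_two, h0, h1, hermiteReal_add_two]
    have : 1 - c ^ 2 = t ^ 2 := by linarith
    rw [this]
    simp
    ring

/-- With `φ` the Gaussian density, `-(He_n φ)` is an antiderivative of `He_{n+1} φ` that vanishes at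
infinity, so only the endpoint `-b` contributes. -/
theorem integral_hermiteReal_indicator (n : ℕ) (b : ℝ) :
    ∫ z, (hermiteReal (n + 1)).eval z * (if 0 ≤ z + b then 1 else 0) ∂γ₁
      = (hermiteReal n).eval (-b) * gaussianPDFReal 0 1 b := by
  have hd : ∀ x ∈ Set.Ioi (-b), HasDerivAt (fun x => -((hermiteReal n).eval x * gaussianPDFReal 0 1 x))
      ((hermiteReal (n + 1)).eval x * gaussianPDFReal 0 1 x) x := fun x _ => by
    refine (hasDerivAt_polynomial_mul_gaussianPDFReal (hermiteReal n) x).neg.congr_deriv ?_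
    rw [hermiteReal_succ]
    simp only [eval_sub, eval_mul, eval_X]
    ring
  have hi := integrable_mul_gaussianPDFReal (integrable_polynomial_gaussianReal (hermiteReal n))
  have hi' := integrable_mul_gaussianPDFReal
    (integrable_polynomial_gaussianReal (hermiteReal (n + 1)))
  have h0 := tendsto_zero_of_hasDerivAt_of_integrableOn_Ioi hd hi'.integrableOn hi.neg.integrableOn
  have hc : ContinuousWithinAt (fun x => -((hermiteReal n).eval x * gaussianPDFReal 0 1 x))
      (Set.Ici (-b)) (-b) :=
    (hasDerivAt_polynomial_mul_gaussianPDFReal (hermiteReal n) (-b)).neg.continuousAt.continuousWithinAt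
  have h := integral_Ioi_of_hasDerivAt_of_tendsto hc hd hi'.integrableOn h0
  rw [integral_gaussianReal_eq]
  have e : ∀ z : ℝ, (hermiteReal (n + 1)).eval z * (if 0 ≤ z + b then 1 else 0)
      * gaussianPDFReal 0 1 z = (Set.Ici (-b)).indicator
        (fun z => (hermiteReal (n + 1)).eval z * gaussianPDFReal 0 1 z) z := by
    intro z
    by_cases hz : 0 ≤ z + b
    · rw [Set.indicator_of_mem (show z ∈ Set.Ici (-b) by simp only [Set.mem_Ici]; linarith)]
      simp [hz]
    · rw [Set.indicator_of_notMem (show z ∉ Set.Ici (-b) by simp only [Set.mem_Ici]; linarith)]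
      simp [hz]
  simp_rw [e]
  rw [integral_indicator measurableSet_Ici, integral_Ici_eq_integral_Ioi, h]
  have : gaussianPDFReal 0 1 (-b) = gaussianPDFReal 0 1 b := by simp [gaussianPDFReal]
  rw [this]; ring

/-! ### The bias weight and a lower bound for its normalisation -/

/-- A Gaussian factor `exp (-n b² / 2)` and the Gaussian density turn a standard Gaussian average
into one with variance `1 / (n + 2)`. -/
theorem integral_polynomial_mul_exp_mul_gaussianPDFReal (n : ℕ) (R : ℝ[X]) :
    ∫ b, R.eval b * Real.exp (-(n * b ^ 2 / 2)) * gaussianPDFReal 0 1 b ∂γ₁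
      = (√(2 * Real.pi))⁻¹ * (√(n + 2))⁻¹ * ∫ y, R.eval ((√(n + 2))⁻¹ * y) ∂γ₁ := by
  have hpos : (0 : ℝ) < √(n + 2) := Real.sqrt_pos.2 (by positivity)
  rw [integral_gaussianReal_eq, integral_gaussianReal_eq]
  have e : ∀ b : ℝ, R.eval b * Real.exp (-(n * b ^ 2 / 2)) * gaussianPDFReal 0 1 b
      * gaussianPDFReal 0 1 b = (√(2 * Real.pi))⁻¹ * (fun y => R.eval ((√(n + 2))⁻¹ * y) *
        gaussianPDFReal 0 1 y) (√(n + 2) * b) := by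
    intro b
    simp only [gaussianPDFReal]
    rw [inv_mul_cancel_left₀ hpos.ne']
    have : Real.exp (-(√(n + 2) * b - 0) ^ 2 / (2 * ((1 : NNReal) : ℝ)))
        = Real.exp (-(n * b ^ 2 / 2)) * Real.exp (-(b - 0) ^ 2 / (2 * ((1 : NNReal) : ℝ)))
          * Real.exp (-(b - 0) ^ 2 / (2 * ((1 : NNReal) : ℝ))) := by
      rw [← Real.exp_add, ← Real.exp_add]
      congr 1
      have : √((n : ℝ) + 2) ^ 2 = n + 2 := Real.sq_sqrt (by positivity)
      simp
      rw [mul_pow, this]; ring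
    rw [this]
    simp
    ring
  simp_rw [e]
  rw [integral_const_mul, Measure.integral_comp_mul_left (fun y => R.eval ((√(n + 2))⁻¹ * y) *
        gaussianPDFReal 0 1 y), abs_of_pos (inv_pos.2 hpos), smul_eq_mul]
  ring

/-- The product of the first `l` odd numbers. -/
noncomputable def oddProd (l : ℕ) : ℝ := ∏ i ∈ Finset.range l, (2 * (i : ℝ) + 1)

theorem oddProd_succ (l : ℕ) : oddProd (l + 1) = oddProd l * (2 * l + 1) :=
  Finset.prod_range_succ _ _

/-- Here `oddProd l` is `(2l-1)!!`, and `(2l)! = (2l)!! (2l-1)!!` with `(2l)!! ≤ (2l+1)!!`. This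
compares Gaussian averages of Hermite polynomials with their squared norms. -/
theorem factorial_le_oddProd_sq (l : ℕ) :
    ((2 * l).factorial : ℝ) ≤ (2 * l + 1) * oddProd l ^ 2 := by
  induction l with
  | zero => simp [oddProd]
  | succ l ih =>
    rw [oddProd_succ, show 2 * (l + 1) = (2 * l + 1) + 1 by ring, Nat.factorial_succ,
      Nat.factorial_succ]
    push_cast
    have h0 : (0 : ℝ) ≤ oddProd l ^ 2 * (2 * l + 1) ^ 2 := by positivity
    have h1 := mul_le_mul_of_nonneg_left ih (show (0 : ℝ) ≤ (2 * l + 2) * (2 * l + 1) by positivity)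
    nlinarith

theorem integral_hermiteReal_two_mul (c : ℝ) (l : ℕ) :
    ∫ y, (hermiteReal (2 * l)).eval (c * y) ∂γ₁ = (-(1 - c ^ 2)) ^ l * oddProd l := by
  induction l with
  | zero => simp [hermiteReal_zero, oddProd]
  | succ l ih =>
    have h := integral_hermiteReal_affine_add_two 0 c (2 * l)
    simp only [zero_add, zero_mul, zero_sub] at h
    rw [show 2 * (l + 1) = 2 * l + 2 by ring, h, ih, oddProd_succ, pow_succ]
    push_cast
    ring

theorem integral_mul_hermiteReal_succ (c : ℝ) (n : ℕ) :
    ∫ y, (X * hermiteReal (n + 1)).eval (c * y) ∂γ₁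
      = c ^ 2 * (n + 1) * ∫ y, (hermiteReal n).eval (c * y) ∂γ₁ := by
  have h := integral_mul_polynomial_gaussianReal ((hermiteReal (n + 1)).comp (C c * X))
  calc _ = c * ∫ y, y * ((hermiteReal (n + 1)).comp (C c * X)).eval y ∂γ₁ := by
        rw [← integral_const_mul]; congr 1; ext y; simp; ring
    _ = _ := by
        rw [h, derivative_comp, derivative_hermiteReal_succ, ← integral_const_mul,
          ← integral_const_mul]
        congr 1; ext y; simp; ring

/-- A test function for the bias, on which `He_n φ` is not small. -/
noncomputable def biasWeight (n : ℕ) (b : ℝ) : ℝ :=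
  -- The exponential concentrates the bias near the origin, where `He_n` does not oscillate away its
  -- average. For odd `n` that average would vanish by parity, and the factor `b` repairs this.
  (if Even n then 1 else b) * Real.exp (-(n * b ^ 2 / 2))

theorem measurable_biasWeight (n : ℕ) : Measurable (biasWeight n) := by
  unfold biasWeight; split_ifs <;> fun_prop

theorem biasWeight_sq_le (n : ℕ) (b : ℝ) :
    biasWeight n b ^ 2 ≤ if Even n then (1 : ℝ) else 1 / n := by
  unfold biasWeight
  split_ifs with h
  · have : Real.exp (-(n * b ^ 2 / 2)) ≤ 1 := Real.exp_le_one_iff.2 (by simp; positivity)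
    rw [one_mul]; exact pow_le_one₀ (Real.exp_pos _).le this
  · have hn : (0 : ℝ) < n := by
      rcases Nat.eq_zero_or_pos n with rfl | hn
      · simp at h
      · exact_mod_cast hn
    rw [mul_pow, ← Real.exp_nat_mul, le_div_iff₀ hn]
    have h1 := Real.add_one_le_exp (n * b ^ 2)
    have h2 : Real.exp (((2 : ℕ) : ℝ) * -(n * b ^ 2 / 2)) = (Real.exp (n * b ^ 2))⁻¹ := by
      rw [← Real.exp_neg]; congr 1; push_cast; ring
    rw [h2, mul_assoc, mul_comm, mul_assoc, inv_mul_le_iff₀ (Real.exp_pos _)]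
    linarith

/-- The normalisation constant of `biasWeight n`. -/
noncomputable def biasConst (n : ℕ) : ℝ :=
  ∫ b, biasWeight n b * ((hermiteReal n).eval (-b) * gaussianPDFReal 0 1 b) ∂γ₁

theorem hermiteReal_eval_neg (n : ℕ) (x : ℝ) :
    (hermiteReal n).eval (-x) = (-1) ^ n * (hermiteReal n).eval x := by
  induction n using Nat.twoStepInduction with
  | zero => simp [hermiteReal_zero]
  | one => simp [hermiteReal_succ, hermiteReal_zero]
  | more n h0 h1 =>
    rw [hermiteReal_add_two]
    simp [h0, h1]
    ring

theorem half_le_one_sub_pow (l : ℕ) {u : ℝ} (hu : u ≤ 1) (hl : 2 * l * u ≤ 1) :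
    1 / 2 ≤ (1 - u) ^ l := by
  have h := one_add_mul_le_pow (show (-2 : ℝ) ≤ -u by linarith) l
  rw [← sub_eq_add_neg] at h
  linarith

/-- The effective variance is `c² = 1/(2l+2)`, so by Bernoulli the factor `(1 - c²)^l` in the
Hermite average is at least 1/2. -/
theorem biasConst_two_mul_sq (l : ℕ) :
    ((2 * l).factorial : ℝ) / (8 * Real.pi * (2 * l + 2) * (2 * l + 1))
      ≤ biasConst (2 * l) ^ 2 := by
  have h1 : biasConst (2 * l) = (√(2 * Real.pi))⁻¹ * (√((2 * l : ℕ) + 2))⁻¹ *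
      ((-(1 - (√((2 * l : ℕ) + 2))⁻¹ ^ 2)) ^ l * oddProd l) := by
    rw [← integral_hermiteReal_two_mul, ← integral_polynomial_mul_exp_mul_gaussianPDFReal]
    unfold biasConst biasWeight
    congr 1; ext b
    rw [hermiteReal_eval_neg]
    simp
    ring
  have hs : (√((2 * l : ℕ) + 2 : ℝ))⁻¹ ^ 2 = 1 / (2 * l + 2) := by
    rw [inv_pow, Real.sq_sqrt (by positivity)]; push_cast; ring
  have hp : (√(2 * Real.pi))⁻¹ ^ 2 = 1 / (2 * Real.pi) := by
    rw [inv_pow, Real.sq_sqrt (by positivity)]; ring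
  have hb : (1 : ℝ) / 2 ≤ (1 - 1 / (2 * l + 2)) ^ l := by
    apply half_le_one_sub_pow
    · rw [div_le_one (by positivity)]; linarith [(Nat.cast_nonneg l : (0 : ℝ) ≤ l)]
    · rw [mul_one_div, div_le_one (by positivity)]; linarith
  have hf := factorial_le_oddProd_sq l
  rw [h1, mul_pow, mul_pow, mul_pow, hs, hp, neg_pow, mul_pow, ← pow_mul, mul_comm l 2,
    pow_mul (-1 : ℝ) 2 l, neg_one_sq, one_pow, one_mul]
  have hb2 : (1 : ℝ) / 4 ≤ ((1 - 1 / (2 * l + 2)) ^ l) ^ 2 := by nlinarith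
  have hpi := Real.pi_pos
  calc ((2 * l).factorial : ℝ) / (8 * Real.pi * (2 * l + 2) * (2 * l + 1))
      ≤ ((2 * l + 1) * oddProd l ^ 2) / (8 * Real.pi * (2 * l + 2) * (2 * l + 1)) := by gcongr
    _ = 1 / (2 * Real.pi) * (1 / (2 * l + 2)) * (1 / 4 * oddProd l ^ 2) := by
        field_simp; ring
    _ ≤ _ := by gcongr

/-- One more integration by parts absorbs the factor `b` and reduces to even degree, at the cost of
`c² (2l+1)` with `c² = 1/(2l+3)`, which is bounded below. -/
theorem biasConst_two_mul_add_one_sq (l : ℕ) :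
    ((2 * l + 1).factorial : ℝ) / (8 * Real.pi * (2 * l + 3) ^ 3)
      ≤ biasConst (2 * l + 1) ^ 2 := by
  have hodd : ¬ Even (2 * l + 1) := by simp
  have h1 : biasConst (2 * l + 1) = -((√(2 * Real.pi))⁻¹ * (√((2 * l + 1 : ℕ) + 2))⁻¹ *
      ((√((2 * l + 1 : ℕ) + 2))⁻¹ ^ 2 * ((2 * l : ℕ) + 1) *
        ((-(1 - (√((2 * l + 1 : ℕ) + 2))⁻¹ ^ 2)) ^ l * oddProd l))) := by
    rw [← integral_hermiteReal_two_mul, ← integral_mul_hermiteReal_succ,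
      ← integral_polynomial_mul_exp_mul_gaussianPDFReal, ← integral_neg]
    unfold biasConst biasWeight
    congr 1; ext b
    rw [hermiteReal_eval_neg, if_neg hodd]
    simp [pow_succ, pow_mul]
    ring
  have hs : (√((2 * l + 1 : ℕ) + 2 : ℝ))⁻¹ ^ 2 = 1 / (2 * l + 3) := by
    rw [inv_pow, Real.sq_sqrt (by positivity)]; push_cast; ring
  have hp : (√(2 * Real.pi))⁻¹ ^ 2 = 1 / (2 * Real.pi) := by
    rw [inv_pow, Real.sq_sqrt (by positivity)]; ring
  have hb : (1 : ℝ) / 2 ≤ (1 - 1 / (2 * l + 3)) ^ l := by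
    apply half_le_one_sub_pow
    · rw [div_le_one (by positivity)]; linarith [(Nat.cast_nonneg l : (0 : ℝ) ≤ l)]
    · rw [mul_one_div, div_le_one (by positivity)]; linarith
  have hf := factorial_le_oddProd_sq l
  rw [h1, neg_sq, mul_pow, mul_pow, mul_pow, mul_pow, mul_pow _ (oddProd l), hs, hp, neg_pow,
    mul_pow (_ ^ l), ← pow_mul, mul_comm l 2, pow_mul (-1 : ℝ) 2 l, neg_one_sq, one_pow, one_mul]
  have hb2 : (1 : ℝ) / 4 ≤ ((1 - 1 / (2 * l + 3)) ^ l) ^ 2 := by nlinarith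
  have hpi := Real.pi_pos
  rw [Nat.factorial_succ]
  push_cast
  calc ((2 * l + 1) * ((2 * l).factorial : ℝ)) / (8 * Real.pi * (2 * l + 3) ^ 3)
      ≤ ((2 * l + 1) * ((2 * l + 1) * oddProd l ^ 2)) / (8 * Real.pi * (2 * l + 3) ^ 3) := by
        gcongr
    _ = 1 / (2 * Real.pi) * (1 / (2 * l + 3)) *
        ((1 / (2 * l + 3)) ^ 2 * (2 * l + 1) ^ 2 * (1 / 4 * oddProd l ^ 2)) := by
        field_simp; ring
    _ ≤ _ := by
        gcongr

theorem biasConst_ne_zero (n : ℕ) : biasConst n ≠ 0 := by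
  have hpi := Real.pi_pos
  rw [← sq_pos_iff]
  rcases Nat.even_or_odd' n with ⟨l, rfl | rfl⟩
  · exact lt_of_lt_of_le (by positivity) (biasConst_two_mul_sq l)
  · exact lt_of_lt_of_le (by positivity) (biasConst_two_mul_add_one_sq l)

/-- This bounds the second moment of the coefficient `He_{n+1} · biasWeight / biasConst`: `(n+1)!`
is the squared norm of the Hermite factor, and the first factor bounds the squared weight. The
constant 200 is dictated by `n = 1`, where about `8π · 27 / 4 ≈ 170` is needed. -/
theorem factorial_le_biasConst_sq (n : ℕ) :
    (if Even n then (1 : ℝ) else 1 / n) * (n + 1).factorial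
      ≤ 200 * (n + 1) ^ 3 * biasConst n ^ 2 := by
  have hpi := Real.pi_lt_d2
  have hpi0 := Real.pi_pos
  rw [Nat.factorial_succ]
  rcases Nat.even_or_odd' n with ⟨l, rfl | rfl⟩
  · have h := biasConst_two_mul_sq l
    rw [if_pos (by simp)]
    refine le_trans ?_ (mul_le_mul_of_nonneg_left h (by positivity))
    rw [mul_div_assoc', le_div_iff₀ (by positivity)]
    have hl : (0 : ℝ) ≤ l := Nat.cast_nonneg l
    push_cast
    have : 8 * Real.pi * (2 * l + 2) ≤ 200 * (2 * l + 1 : ℝ) := by nlinarith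
    calc 1 * ((2 * (l : ℝ) + 1) * (2 * l).factorial) * (8 * Real.pi * (2 * l + 2) * (2 * l + 1))
        = (8 * Real.pi * (2 * l + 2)) * ((2 * l + 1) ^ 2 * (2 * l).factorial) := by ring
      _ ≤ (200 * (2 * l + 1 : ℝ)) * ((2 * l + 1) ^ 2 * (2 * l).factorial) := by gcongr
      _ = _ := by ring
  · have h := biasConst_two_mul_add_one_sq l
    rw [if_neg (by simp)]
    refine le_trans ?_ (mul_le_mul_of_nonneg_left h (by positivity))
    have hl : (0 : ℝ) ≤ l := Nat.cast_nonneg l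
    push_cast
    rw [mul_div_assoc', div_mul_eq_mul_div, div_le_div_iff₀ (by positivity) (by positivity)]
    have : 8 * Real.pi * (2 * l + 3) ^ 3 ≤ 200 * (2 * l + 1 + 1 : ℝ) ^ 2 * (2 * l + 1) := by
      have h1 : 8 * Real.pi * (2 * l + 3) ^ 3 ≤ 8 * 3.15 * (2 * l + 3 : ℝ) ^ 3 := by gcongr
      nlinarith [pow_nonneg hl 2, pow_nonneg hl 3]
    calc 1 * ((2 * (l : ℝ) + 1 + 1) * (2 * l + 1).factorial) * (8 * Real.pi * (2 * l + 3) ^ 3)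
        = (8 * Real.pi * (2 * l + 3) ^ 3) * ((2 * l + 1 + 1) * (2 * l + 1).factorial) := by ring
      _ ≤ (200 * (2 * l + 1 + 1 : ℝ) ^ 2 * (2 * l + 1)) *
          ((2 * l + 1 + 1) * (2 * l + 1).factorial) := by gcongr
      _ = _ := by ring

/-! ### Gaussian projections and powers as averages of threshold features -/

/-- The step function `1{u ≥ 0}`. -/
noncomputable def step (u : ℝ) : ℝ := if 0 ≤ u then 1 else 0

theorem measurable_step : Measurable step :=
  Measurable.ite measurableSet_Ici measurable_const measurable_const

theorem step_nonneg (u : ℝ) : 0 ≤ step u := by unfold step; split_ifs <;> norm_num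

theorem step_le_one (u : ℝ) : step u ≤ 1 := by unfold step; split_ifs <;> norm_num

theorem abs_step_le_one (u : ℝ) : |step u| ≤ 1 := by
  rw [abs_of_nonneg (step_nonneg u)]; exact step_le_one u

theorem step_sq (u : ℝ) : step u ^ 2 = step u := by unfold step; split_ifs <;> norm_num

theorem integral_step_gaussianReal {v : NNReal} (hv : v ≠ 0) :
    ∫ u, step u ∂(gaussianReal 0 v) = 1 / 2 := by
  have := nullSingletonClass_gaussianReal (μ := 0) hv
  have hi : Integrable step (gaussianReal 0 v) :=
    Integrable.of_bound measurable_step.aestronglyMeasurable 1 (ae_of_all _ abs_step_le_one)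
  have hmp : MeasurePreserving (fun u : ℝ => -u) (gaussianReal 0 v) (gaussianReal 0 v) :=
    ⟨measurable_neg, by rw [gaussianReal_map_neg, neg_zero]⟩
  have hneg : ∫ u, step (-u) ∂(gaussianReal 0 v) = ∫ u, step u ∂(gaussianReal 0 v) :=
    hmp.integral_comp (MeasurableEquiv.neg ℝ).measurableEmbedding _
  have hsum : ∫ u, (step u + step (-u)) ∂(gaussianReal 0 v) = 1 := by
    have : (fun u => step u + step (-u)) =ᵐ[gaussianReal 0 v] fun _ => (1 : ℝ) := by
      filter_upwards [compl_mem_ae_iff.2 (measure_singleton (μ := gaussianReal 0 v) (0 : ℝ))]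
        with u hu
      have hu : u ≠ 0 := hu
      unfold step
      rcases lt_or_gt_of_ne hu with h | h
      · rw [if_neg (by linarith), if_pos (by linarith)]; norm_num
      · rw [if_pos (by linarith), if_neg (by linarith)]; norm_num
    rw [integral_congr_ae this]; simp
  have hi' : Integrable (fun u => step (-u)) (gaussianReal 0 v) := hmp.integrable_comp_of_integrable hi
  rw [integral_add hi hi', hneg] at hsum
  linarith

section
variable {E : Type*} [NormedAddCommGroup E] [InnerProductSpace ℝ E] [FiniteDimensional ℝ E]
  [MeasurableSpace E] [BorelSpace E]

theorem map_inner_stdGaussian (w : E) :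
    (stdGaussian E).map (fun v => inner ℝ v w) = gaussianReal 0 (‖w‖ ^ 2).toNNReal := by
  have h := IsGaussian.map_eq_gaussianReal (μ := stdGaussian E) (innerSL ℝ w)
  rw [integral_strongDual_stdGaussian, variance_dual_stdGaussian, innerSL_apply_norm] at h
  rw [← h]
  congr 1
  ext v
  simp [real_inner_comm]

theorem integral_step_inner {w : E} (hw : w ≠ 0) :
    ∫ v, step (inner ℝ v w) ∂(stdGaussian E) = 1 / 2 := by
  rw [← integral_step_gaussianReal (v := (‖w‖ ^ 2).toNNReal)
    (by simpa [Real.toNNReal_eq_zero] using hw), ← map_inner_stdGaussian,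
    integral_map (by fun_prop) measurable_step.aestronglyMeasurable]

/-- The bias keeps the variance `‖x‖² + 1` positive for every `x`. This is the case of exponent zero
of the feature representation. -/
theorem integral_step_inner_add (x : E) :
    ∫ q : E × ℝ, step (inner ℝ q.1 x + q.2) ∂((stdGaussian E).prod γ₁) = 1 / 2 := by
  have hlaw : ((stdGaussian E).prod γ₁).map (fun q : E × ℝ => inner ℝ q.1 x + q.2)
      = gaussianReal 0 ((‖x‖ ^ 2).toNNReal + 1) := by
    have h := gaussianReal_conv_gaussianReal (m₁ := 0) (m₂ := 0) (v₁ := (‖x‖ ^ 2).toNNReal) (v₂ := 1)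
    rw [← map_inner_stdGaussian, Measure.conv] at h
    conv_lhs at h => rw [← Measure.map_id (μ := γ₁)]
    rw [Measure.map_prod_map _ _ (by fun_prop) (by fun_prop), Measure.map_map (by fun_prop)
      (by fun_prop), add_zero] at h
    exact h
  rw [← integral_step_gaussianReal (v := (‖x‖ ^ 2).toNNReal + 1) (by simp), ← hlaw,
    integral_map (by fun_prop) measurable_step.aestronglyMeasurable]

/-- Characteristic functions: with `l₁ = L (1, 0)` and `l₂ = L (0, 1)`, the functional `L` is
centred Gaussian with variance `l₁² + 2 t l₁ l₂ + l₂²` under either law. -/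
theorem map_inner_pair_stdGaussian {x e : E} (hx : ‖x‖ = 1) (he : ‖e‖ = 1) {c : ℝ}
    (hc : inner ℝ e x ^ 2 + c ^ 2 = 1) :
    (stdGaussian E).map (fun v => (inner ℝ v x, inner ℝ v e))
      = (Measure.prod γ₁ γ₁).map (fun q : ℝ × ℝ => (q.1, inner ℝ e x * q.1 + c * q.2)) := by
  set t : ℝ := inner ℝ e x with ht
  let A : E →L[ℝ] ℝ × ℝ := (innerSL ℝ x).prod (innerSL ℝ e)
  let B : ℝ × ℝ →L[ℝ] ℝ × ℝ := (ContinuousLinearMap.fst ℝ ℝ ℝ).prod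
    (t • ContinuousLinearMap.fst ℝ ℝ ℝ + c • ContinuousLinearMap.snd ℝ ℝ ℝ)
  have hA : (fun v => (inner ℝ v x, inner ℝ v e)) = A := by
    ext v <;> simp [A, real_inner_comm]
  have hB : (fun q : ℝ × ℝ => (q.1, t * q.1 + c * q.2)) = B := by
    ext v <;> simp [B]
  rw [hA, hB]
  have := Measure.isProbabilityMeasure_map (μ := stdGaussian E) (f := A) (by fun_prop)
  have := Measure.isProbabilityMeasure_map (μ := Measure.prod γ₁ γ₁) (f := B) (by fun_prop)
  apply Measure.ext_of_charFunDual
  ext L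
  have hγ : ∀ M : StrongDual ℝ ℝ, charFunDual γ₁ M = Complex.exp (-((M 1 : ℝ) : ℂ) ^ 2 / 2) := by
    intro M
    rw [IsGaussian.charFunDual_eq, integral_complex_ofReal, integral_continuousLinearMap_gaussianReal,
      variance_continuousLinearMap_gaussianReal]
    simp [neg_div, max_eq_left (sq_nonneg (M 1))]
  rw [charFunDual_map, charFunDual_map, charFunDual_prod, hγ, hγ, charFunDual_stdGaussian,
    ← Complex.exp_add]
  have hL : ∀ q : ℝ × ℝ, L q = q.1 * L (1, 0) + q.2 * L (0, 1) := by
    intro q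
    have : q = q.1 • ((1 : ℝ), (0 : ℝ)) + q.2 • ((0 : ℝ), (1 : ℝ)) := by ext <;> simp
    conv_lhs => rw [this]
    rw [map_add, map_smul, map_smul, smul_eq_mul, smul_eq_mul]
  have hLA : L.comp A = innerSL ℝ (L (1, 0) • x + L (0, 1) • e) := by
    ext v
    rw [ContinuousLinearMap.comp_apply, hL]
    simp [A]
    ring
  have hn : ‖L.comp A‖ ^ 2 = L (1, 0) ^ 2 + 2 * (L (1, 0) * L (0, 1) * t) + L (0, 1) ^ 2 := by
    rw [hLA, innerSL_apply_norm, norm_add_sq_real, norm_smul, norm_smul, hx, he, inner_smul_left,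
      inner_smul_right, real_inner_comm, ← ht]
    simp
    ring
  have h1 : ((L.comp B).comp (ContinuousLinearMap.inl ℝ ℝ ℝ)) 1 = L (1, 0) + t * L (0, 1) := by
    simp only [ContinuousLinearMap.comp_apply]
    rw [hL]
    simp [B]
  have h2 : ((L.comp B).comp (ContinuousLinearMap.inr ℝ ℝ ℝ)) 1 = c * L (0, 1) := by
    simp only [ContinuousLinearMap.comp_apply]
    rw [hL]
    simp [B]
  rw [h1, h2]
  congr 1
  rw [← Complex.ofReal_pow, hn]
  have hc' : c ^ 2 = 1 - t ^ 2 := by linarith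
  norm_cast
  rw [mul_pow c, hc']
  ring

/-- The step depends only on `y = vᵀx`, while `vᵀe = t y + c y'` with `y'` independent of `y`.
Averaging over `y'` first leaves `t ^ (n + 1) He_{n+1}(y)` against a one-dimensional threshold. -/
theorem integral_hermiteReal_inner_mul_step {x e : E} (hx : ‖x‖ = 1) (he : ‖e‖ = 1) (n : ℕ)
    (b : ℝ) :
    ∫ v, (hermiteReal (n + 1)).eval (inner ℝ v e) * step (inner ℝ v x + b) ∂(stdGaussian E)
      = inner ℝ e x ^ (n + 1) * ((hermiteReal n).eval (-b) * gaussianPDFReal 0 1 b) := by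
  set t : ℝ := inner ℝ e x with ht
  have ht1 : t ^ 2 ≤ 1 := by
    have := abs_real_inner_le_norm e x
    rw [hx, he, mul_one, ← ht] at this
    exact (sq_le_one_iff_abs_le_one _).2 this
  have hc : t ^ 2 + √(1 - t ^ 2) ^ 2 = 1 := by rw [Real.sq_sqrt (by linarith)]; ring
  have hlaw := map_inner_pair_stdGaussian hx he (ht ▸ hc)
  rw [← ht] at hlaw
  set c := √(1 - t ^ 2)
  have hm : Measurable fun q : ℝ × ℝ => (hermiteReal (n + 1)).eval q.2 * step (q.1 + b) :=
    ((hermiteReal (n + 1)).continuous.measurable.comp measurable_snd).mul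
      (measurable_step.comp (by fun_prop))
  have hm' : Measurable fun q : ℝ × ℝ => (q.1, t * q.1 + c * q.2) := by fun_prop
  have hA : Measurable fun v : E => (inner ℝ v x, inner ℝ v e) := by fun_prop
  have hint : Integrable (fun q : ℝ × ℝ => (hermiteReal (n + 1)).eval (t * q.1 + c * q.2) *
      step (q.1 + b)) (Measure.prod γ₁ γ₁) := by
    have h0 : Integrable (fun q : ℝ × ℝ => (hermiteReal (n + 1)).eval q.2)
        ((Measure.prod γ₁ γ₁).map fun q : ℝ × ℝ => (q.1, t * q.1 + c * q.2)) := by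
      rw [← hlaw, integrable_map_measure (by fun_prop) (by fun_prop)]
      have : Integrable (fun z => (hermiteReal (n + 1)).eval z)
          ((stdGaussian E).map fun v => inner ℝ v e) := by
        rw [map_inner_stdGaussian, he]
        simpa using integrable_polynomial_gaussianReal (hermiteReal (n + 1))
      rw [integrable_map_measure (by fun_prop) (by fun_prop)] at this
      exact this
    rw [integrable_map_measure (by fun_prop) (by fun_prop)] at h0
    exact h0.mul_bdd (c := 1) (measurable_step.comp (by fun_prop)).aestronglyMeasurable
      (ae_of_all _ fun q => abs_step_le_one _)
  calc _ = ∫ q, (hermiteReal (n + 1)).eval q.2 * step (q.1 + b)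
          ∂((stdGaussian E).map fun v => (inner ℝ v x, inner ℝ v e)) := by
        rw [integral_map hA.aemeasurable hm.aestronglyMeasurable]
    _ = ∫ q, (hermiteReal (n + 1)).eval (t * q.1 + c * q.2) * step (q.1 + b) ∂(Measure.prod γ₁ γ₁) := by
        rw [hlaw, integral_map hm'.aemeasurable hm.aestronglyMeasurable]
    _ = ∫ y, ∫ y', (hermiteReal (n + 1)).eval (t * y + c * y') * step (y + b) ∂γ₁ ∂γ₁ :=
        integral_prod _ hint
    _ = ∫ y, t ^ (n + 1) * ((hermiteReal (n + 1)).eval y * (if 0 ≤ y + b then 1 else 0)) ∂γ₁ := by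
        congr 1; ext y
        rw [integral_mul_const, integral_hermiteReal_rotate hc]
        simp only [step]; ring
    _ = _ := by rw [integral_const_mul, integral_hermiteReal_indicator]

/-- Power functions on the sphere are averages of random indicator features. -/
theorem exists_feature_coeff_pow_succ {e : E} (he : ‖e‖ = 1) (n : ℕ) :
    ∃ q : E × ℝ → ℝ, Measurable q ∧ Integrable (fun u => q u ^ 2) ((stdGaussian E).prod γ₁) ∧
      ∫ u, q u ^ 2 ∂((stdGaussian E).prod γ₁) ≤ 200 * ((n : ℝ) + 1) ^ 3 ∧
      ∀ x : E, ‖x‖ = 1 → ∫ u, q u * step (inner ℝ u.1 x + u.2) ∂((stdGaussian E).prod γ₁)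
        = inner ℝ e x ^ (n + 1) := by
  have hJ := biasConst_ne_zero n
  have hw := measurable_biasWeight n
  set κ : ℝ := if Even n then (1 : ℝ) else 1 / n with hκ
  have hwb : ∀ b, biasWeight n b ^ 2 ≤ κ := biasWeight_sq_le n
  have hHm : Measurable fun v : E => (hermiteReal (n + 1)).eval (inner ℝ v e) :=
    (hermiteReal (n + 1)).continuous.measurable.comp (by fun_prop)
  have hlaw : ((stdGaussian E).map fun v => inner ℝ v e) = γ₁ := by
    rw [map_inner_stdGaussian, he]; simp
  have hH1 : Integrable (fun v : E => (hermiteReal (n + 1)).eval (inner ℝ v e)) (stdGaussian E) := by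
    have := integrable_polynomial_gaussianReal (hermiteReal (n + 1))
    rw [← hlaw, integrable_map_measure (by fun_prop) (by fun_prop)] at this
    exact this
  have hH2 : Integrable (fun v : E => (hermiteReal (n + 1)).eval (inner ℝ v e) ^ 2)
      (stdGaussian E) := by
    have := (integrable_polynomial_gaussianReal (hermiteReal (n + 1) ^ 2)).congr
      (ae_of_all _ fun x => by simp : _ =ᵐ[γ₁] fun x => (hermiteReal (n + 1)).eval x ^ 2)
    rw [← hlaw, integrable_map_measure (by fun_prop) (by fun_prop)] at this
    exact this
  have hH3 : ∫ v, (hermiteReal (n + 1)).eval (inner ℝ v e) ^ 2 ∂(stdGaussian E)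
      = (n + 1).factorial := by
    rw [← integral_hermiteReal_sq, ← hlaw, integral_map (by fun_prop) (by fun_prop)]
  have hw2 : Integrable (fun b => biasWeight n b ^ 2) γ₁ :=
    Integrable.of_bound (hw.pow_const 2).aestronglyMeasurable κ (ae_of_all _ fun b => by
      rw [Real.norm_of_nonneg (sq_nonneg _)]; exact hwb b)
  have hw1 : Integrable (biasWeight n) γ₁ :=
    (MemLp.integrable one_le_two ((memLp_two_iff_integrable_sq hw.aestronglyMeasurable).2 hw2))
  have hw3 : ∫ b, biasWeight n b ^ 2 ∂γ₁ ≤ κ := by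
    calc _ ≤ ∫ _, κ ∂γ₁ := integral_mono hw2 (integrable_const _) hwb
      _ = κ := by simp
  -- The Hermite factor produces the power of `eᵀx`; the bias factor is normalised so that the
  -- remaining integral over `b` equals 1.
  refine ⟨fun u => (hermiteReal (n + 1)).eval (inner ℝ u.1 e) * ((biasConst n)⁻¹ *
    biasWeight n u.2), ?_, ?_, ?_, ?_⟩
  · exact (hHm.comp measurable_fst).mul (measurable_const.mul (hw.comp measurable_snd))
  · have := hH2.mul_prod (hw2.const_mul ((biasConst n)⁻¹ ^ 2))
    simpa only [mul_pow] using this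
  · simp only [mul_pow]
    rw [integral_prod_mul (fun v : E => (hermiteReal (n + 1)).eval (inner ℝ v e) ^ 2)
      (fun b => (biasConst n)⁻¹ ^ 2 * biasWeight n b ^ 2), integral_const_mul, hH3]
    have hf := factorial_le_biasConst_sq n
    rw [← hκ] at hf
    have hJ2 : 0 < biasConst n ^ 2 := by positivity
    calc _ ≤ ((n + 1).factorial : ℝ) * ((biasConst n)⁻¹ ^ 2 * κ) := by gcongr
      _ = (κ * (n + 1).factorial) / biasConst n ^ 2 := by field_simp
      _ ≤ _ := by rw [div_le_iff₀ hJ2]; exact hf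
  · intro x hx
    have hint : Integrable (fun u : E × ℝ => (hermiteReal (n + 1)).eval (inner ℝ u.1 e) *
        ((biasConst n)⁻¹ * biasWeight n u.2) * step (inner ℝ u.1 x + u.2))
        ((stdGaussian E).prod γ₁) :=
      (hH1.mul_prod (hw1.const_mul _)).mul_bdd (c := 1)
        (measurable_step.comp (by fun_prop)).aestronglyMeasurable
        (ae_of_all _ fun q => abs_step_le_one _)
    rw [integral_prod_symm _ hint]
    have h1 : ∀ b : ℝ, ∫ v : E, (hermiteReal (n + 1)).eval (inner ℝ v e) *
        ((biasConst n)⁻¹ * biasWeight n b) * step (inner ℝ v x + b) ∂(stdGaussian E)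
        = inner ℝ e x ^ (n + 1) * (biasConst n)⁻¹ * (biasWeight n b *
          ((hermiteReal n).eval (-b) * gaussianPDFReal 0 1 b)) := by
      intro b
      calc _ = (biasConst n)⁻¹ * biasWeight n b * ∫ v : E, (hermiteReal (n + 1)).eval (inner ℝ v e) *
            step (inner ℝ v x + b) ∂(stdGaussian E) := by
            rw [← integral_const_mul]; congr 1; ext v; ring
        _ = _ := by rw [integral_hermiteReal_inner_mul_step hx he]; ring
    simp_rw [h1]
    rw [integral_const_mul]
    change _ * biasConst n = _
    field_simp

/-- Homogeneity reduces to a unit direction. Exponent zero uses the constant coefficient 2, since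
the step has mean 1/2; `max n 1` makes room for it in the bound. -/
theorem exists_feature_coeff (β : E) (n : ℕ) :
    ∃ q : E × ℝ → ℝ, Measurable q ∧ Integrable (fun u => q u ^ 2) ((stdGaussian E).prod γ₁) ∧
      ∫ u, q u ^ 2 ∂((stdGaussian E).prod γ₁) ≤ 200 * ((max n 1 : ℕ) : ℝ) ^ 3 * ‖β‖ ^ (2 * n) ∧
      ∀ x : E, ‖x‖ = 1 → ∫ u, q u * step (inner ℝ u.1 x + u.2) ∂((stdGaussian E).prod γ₁)
        = inner ℝ β x ^ n := by
  rcases n with _ | n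
  · refine ⟨fun _ => 2, measurable_const, integrable_const _, by simp; norm_num, fun x _ => ?_⟩
    rw [integral_const_mul, integral_step_inner_add]; norm_num
  rcases eq_or_ne β 0 with rfl | hβ
  · exact ⟨fun _ => 0, measurable_const, by simp, by simp, by simp⟩
  obtain ⟨q, hm, hi, hb, h⟩ := exists_feature_coeff_pow_succ (e := ‖β‖⁻¹ • β)
    (norm_smul_inv_norm (𝕜 := ℝ) hβ) n
  have hβ' : ‖β‖ ≠ 0 := norm_ne_zero_iff.2 hβ
  refine ⟨fun u => ‖β‖ ^ (n + 1) * q u, measurable_const.mul hm, ?_, ?_, fun x hx => ?_⟩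
  · simpa only [mul_pow] using hi.const_mul ((‖β‖ ^ (n + 1)) ^ 2)
  · simp only [mul_pow]
    rw [integral_const_mul]
    have : ((max (n + 1) 1 : ℕ) : ℝ) = n + 1 := by simp
    rw [this, ← pow_mul, mul_comm (n + 1) 2, mul_comm]
    gcongr
  · simp only [mul_assoc]
    rw [integral_const_mul, h x hx, inner_smul_left, mul_pow]
    simp [hβ']

end

/-! ### Moments of independent sums and Monte Carlo with truncation -/

theorem integrable_of_abs_le {Ω : Type*} [MeasurableSpace Ω] {μ : Measure Ω} [IsFiniteMeasure μ]
    {f : Ω → ℝ} (hf : Measurable f) (K : ℝ) (hK : ∀ ω, |f ω| ≤ K) : Integrable f μ :=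
  Integrable.of_bound hf.aestronglyMeasurable K (ae_of_all _ hK)

theorem integral_add_sq_prod {Ω Ω' : Type*} [MeasurableSpace Ω] [MeasurableSpace Ω']
    {μ : Measure Ω} {ν : Measure Ω'} [IsProbabilityMeasure μ] [IsProbabilityMeasure ν]
    {X : Ω → ℝ} {Y : Ω' → ℝ} (hX : Measurable X) (hY : Measurable Y) {K L : ℝ}
    (hK : ∀ ω, |X ω| ≤ K) (hL : ∀ ω, |Y ω| ≤ L) :
    ∫ z, (X z.1 + Y z.2) ^ 2 ∂(μ.prod ν)
      = ∫ ω, X ω ^ 2 ∂μ + 2 * ((∫ ω, X ω ∂μ) * ∫ ω, Y ω ∂ν) + ∫ ω, Y ω ^ 2 ∂ν := by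
  have hXi : ∀ n : ℕ, Integrable (fun ω => X ω ^ n) μ := fun n =>
    integrable_of_abs_le (hX.pow_const n) (K ^ n) fun ω => by
      rw [abs_pow]; exact pow_le_pow_left₀ (abs_nonneg _) (hK ω) n
  have hYi : ∀ n : ℕ, Integrable (fun ω => Y ω ^ n) ν := fun n =>
    integrable_of_abs_le (hY.pow_const n) (L ^ n) fun ω => by
      rw [abs_pow]; exact pow_le_pow_left₀ (abs_nonneg _) (hL ω) n
  have hI : ∀ i j : ℕ, Integrable (fun z : Ω × Ω' => X z.1 ^ i * Y z.2 ^ j) (μ.prod ν) :=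
    fun i j => (hXi i).mul_prod (hYi j)
  have hv : ∀ i j : ℕ, ∫ z : Ω × Ω', X z.1 ^ i * Y z.2 ^ j ∂(μ.prod ν)
      = (∫ ω, X ω ^ i ∂μ) * ∫ ω, Y ω ^ j ∂ν := fun i j =>
    integral_prod_mul (fun ω => X ω ^ i) (fun ω => Y ω ^ j)
  have e : ∀ z : Ω × Ω', (X z.1 + Y z.2) ^ 2 = X z.1 ^ 2 * Y z.2 ^ 0 +
      2 * (X z.1 ^ 1 * Y z.2 ^ 1) + X z.1 ^ 0 * Y z.2 ^ 2 := fun z => by ring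
  simp_rw [e]
  rw [integral_add (by exact (hI 2 0).add ((hI 1 1).const_mul 2)) (hI 0 2),
    integral_add (hI 2 0) ((hI 1 1).const_mul 2), integral_const_mul, hv, hv, hv]
  simp

theorem integral_add_pow_four_prod {Ω Ω' : Type*} [MeasurableSpace Ω] [MeasurableSpace Ω']
    {μ : Measure Ω} {ν : Measure Ω'} [IsProbabilityMeasure μ] [IsProbabilityMeasure ν]
    {X : Ω → ℝ} {Y : Ω' → ℝ} (hX : Measurable X) (hY : Measurable Y) {K L : ℝ}
    (hK : ∀ ω, |X ω| ≤ K) (hL : ∀ ω, |Y ω| ≤ L) (hX0 : ∫ ω, X ω ∂μ = 0) (hY0 : ∫ ω, Y ω ∂ν = 0) :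
    ∫ z, (X z.1 + Y z.2) ^ 4 ∂(μ.prod ν)
      = ∫ ω, X ω ^ 4 ∂μ + 6 * ((∫ ω, X ω ^ 2 ∂μ) * ∫ ω, Y ω ^ 2 ∂ν) + ∫ ω, Y ω ^ 4 ∂ν := by
  have hXi : ∀ n : ℕ, Integrable (fun ω => X ω ^ n) μ := fun n =>
    integrable_of_abs_le (hX.pow_const n) (K ^ n) fun ω => by
      rw [abs_pow]; exact pow_le_pow_left₀ (abs_nonneg _) (hK ω) n
  have hYi : ∀ n : ℕ, Integrable (fun ω => Y ω ^ n) ν := fun n =>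
    integrable_of_abs_le (hY.pow_const n) (L ^ n) fun ω => by
      rw [abs_pow]; exact pow_le_pow_left₀ (abs_nonneg _) (hL ω) n
  have hI : ∀ i j : ℕ, Integrable (fun z : Ω × Ω' => X z.1 ^ i * Y z.2 ^ j) (μ.prod ν) :=
    fun i j => (hXi i).mul_prod (hYi j)
  have hv : ∀ i j : ℕ, ∫ z : Ω × Ω', X z.1 ^ i * Y z.2 ^ j ∂(μ.prod ν)
      = (∫ ω, X ω ^ i ∂μ) * ∫ ω, Y ω ^ j ∂ν := fun i j =>
    integral_prod_mul (fun ω => X ω ^ i) (fun ω => Y ω ^ j)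
  have e : ∀ z : Ω × Ω', (X z.1 + Y z.2) ^ 4 = X z.1 ^ 4 * Y z.2 ^ 0 +
      4 * (X z.1 ^ 3 * Y z.2 ^ 1) + 6 * (X z.1 ^ 2 * Y z.2 ^ 2) +
      4 * (X z.1 ^ 1 * Y z.2 ^ 3) + X z.1 ^ 0 * Y z.2 ^ 4 := fun z => by ring
  simp_rw [e]
  have i1 := (hI 4 0).add ((hI 3 1).const_mul 4)
  have i2 := i1.add ((hI 2 2).const_mul 6)
  have i3 := i2.add ((hI 1 3).const_mul 4)
  rw [integral_add (by exact i3) (hI 0 4), integral_add (by exact i2) ((hI 1 3).const_mul 4),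
    integral_add (by exact i1) ((hI 2 2).const_mul 6),
    integral_add (hI 4 0) ((hI 3 1).const_mul 4), integral_const_mul, integral_const_mul,
    integral_const_mul, hv, hv, hv, hv, hv]
  simp [hX0, hY0]

/-- The first, second and fourth moments of a sum of independent copies of a bounded centred
random variable. -/
theorem moments_sum_pi {Θ : Type*} [MeasurableSpace Θ] {γ : Measure Θ} [IsProbabilityMeasure γ]
    {ξ : Θ → ℝ} (hξ : Measurable ξ) {K M : ℝ} (hK : ∀ u, |ξ u| ≤ K) (h0 : ∫ u, ξ u ∂γ = 0)
    (hM : ∫ u, ξ u ^ 2 ∂γ ≤ M) (D : ℕ) :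
    ∫ θ : Fin D → Θ, ∑ j, ξ (θ j) ∂(Measure.pi fun _ => γ) = 0 ∧
    ∫ θ : Fin D → Θ, (∑ j, ξ (θ j)) ^ 2 ∂(Measure.pi fun _ => γ) ≤ D * M ∧
    ∫ θ : Fin D → Θ, (∑ j, ξ (θ j)) ^ 4 ∂(Measure.pi fun _ => γ)
      ≤ D * (K ^ 2 * M) + 3 * D ^ 2 * M ^ 2 := by
  have hM0 : 0 ≤ M := le_trans (integral_nonneg fun u => sq_nonneg _) hM
  have hξi : ∀ n : ℕ, Integrable (fun u => ξ u ^ n) γ := fun n =>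
    integrable_of_abs_le (hξ.pow_const n) (K ^ n) fun ω => by
      rw [abs_pow]; exact pow_le_pow_left₀ (abs_nonneg _) (hK ω) n
  have hξ4 : ∫ u, ξ u ^ 4 ∂γ ≤ K ^ 2 * M := by
    calc _ ≤ ∫ u, K ^ 2 * ξ u ^ 2 ∂γ := by
          refine integral_mono (hξi 4) ((hξi 2).const_mul _) fun u => ?_
          have : ξ u ^ 2 ≤ K ^ 2 := sq_le_sq' (abs_le.1 (hK u)).1 (abs_le.1 (hK u)).2
          change ξ u ^ 4 ≤ K ^ 2 * ξ u ^ 2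
          nlinarith [sq_nonneg (ξ u)]
      _ = K ^ 2 * ∫ u, ξ u ^ 2 ∂γ := integral_const_mul _ _
      _ ≤ _ := by gcongr
  induction D with
  | zero => simp
  | succ D ih =>
    obtain ⟨i1, i2, i4⟩ := ih
    have hmp := (measurePreserving_piFinSuccAbove (fun _ : Fin (D + 1) => γ) 0)
    have key : ∀ n : ℕ, ∫ θ : Fin (D + 1) → Θ, (∑ j, ξ (θ j)) ^ n ∂(Measure.pi fun _ => γ)
        = ∫ z : Θ × (Fin D → Θ), (ξ z.1 + ∑ j, ξ (z.2 j)) ^ n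
            ∂(γ.prod (Measure.pi fun _ => γ)) := by
      intro n
      rw [← hmp.integral_comp (MeasurableEquiv.measurableEmbedding _)]
      congr 1; ext θ
      rw [Fin.sum_univ_succ]
      rfl
    have hSm : Measurable fun θ : Fin D → Θ => ∑ j, ξ (θ j) :=
      Finset.measurable_sum _ fun j _ => hξ.comp (measurable_pi_apply j)
    have hSb : ∀ θ : Fin D → Θ, |∑ j, ξ (θ j)| ≤ D * K := fun θ => by
      refine (Finset.abs_sum_le_sum_abs _ _).trans ((Finset.sum_le_sum fun j _ => hK (θ j)).trans ?_)
      simp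
    refine ⟨?_, ?_, ?_⟩
    · have h := key 1
      simp only [pow_one] at h
      rw [h, integral_add, integral_fun_fst (μ := γ) ξ,
        integral_fun_snd (fun θ : Fin D → Θ => ∑ j, ξ (θ j)), h0, i1]
      · simp
      · exact (integrable_of_abs_le hξ K hK).comp_fst _
      · exact (integrable_of_abs_le hSm _ hSb).comp_snd _
    · rw [key, integral_add_sq_prod hξ hSm hK hSb, h0]
      push_cast
      linarith
    · rw [key, integral_add_pow_four_prod hξ hSm hK hSb h0 i1]
      have hS2 : 0 ≤ ∫ θ : Fin D → Θ, (∑ j, ξ (θ j)) ^ 2 ∂(Measure.pi fun _ => γ) :=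
        integral_nonneg fun _ => sq_nonneg _
      have hmul := mul_le_mul hM i2 hS2 hM0
      push_cast
      nlinarith [sq_nonneg M]

/-- Monte Carlo approximation with truncated coefficients, in fourth mean. -/
theorem exists_truncated_coeff {Θ : Type*} [MeasurableSpace Θ] {γ : Measure Θ}
    [IsProbabilityMeasure γ] {q : Θ → ℝ} (hq : Measurable q)
    (hq2 : Integrable (fun u => q u ^ 2) γ) {M : ℝ} (hM0 : 0 < M)
    (hM : ∫ u, q u ^ 2 ∂γ ≤ M) {D : ℕ} (hD : 0 < D) :
    ∃ r : Θ → ℝ, Measurable r ∧ (∃ T, ∀ u, |r u| ≤ T) ∧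
      ∀ g : Θ → ℝ, Measurable g → (∀ u, |g u| ≤ 1) →
        ∫ θ : Fin D → Θ, ((D : ℝ)⁻¹ * ∑ j, r (θ j) * g (θ j) - ∫ u, q u * g u ∂γ) ^ 4
          ∂(Measure.pi fun _ => γ) ≤ 64 * (M / D) ^ 2 := by
  have hD' : (0 : ℝ) < D := by exact_mod_cast hD
  -- Only the second moment of `q` is controlled, whereas a fourth moment of the error is wanted. At
  -- this cutoff the truncation bias `M / T` equals `√(M / D)`, the size of the sampling
  -- fluctuation.
  set T : ℝ := √(M * D) with hT
  have hT0 : 0 < T := Real.sqrt_pos.2 (by positivity)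
  have hTsq : T ^ 2 = M * D := Real.sq_sqrt (by positivity)
  set r : Θ → ℝ := fun u => if |q u| ≤ T then q u else 0 with hr
  have hrm : Measurable r :=
    Measurable.ite (measurableSet_le hq.abs measurable_const) hq measurable_const
  have hrT : ∀ u, |r u| ≤ T := fun u => by
    simp only [hr]; split_ifs with h
    · exact h
    · simpa using hT0.le
  have hrq : ∀ u, r u ^ 2 ≤ q u ^ 2 := fun u => by
    simp only [hr]; split_ifs with h
    · exact le_rfl
    · simpa using sq_nonneg _
  have hdiff : ∀ u, |q u - r u| ≤ q u ^ 2 / T := fun u => by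
    simp only [hr]; split_ifs with h
    · simp; positivity
    · push Not at h
      rw [sub_zero, le_div_iff₀ hT0, ← sq_abs (q u), sq]
      gcongr
  -- The truncated coefficient is fixed before `g`, so the same read-out serves all inputs.
  refine ⟨r, hrm, ⟨T, hrT⟩, fun g hg hg1 => ?_⟩
  have hq1 : Integrable q γ := MemLp.integrable one_le_two
    ((memLp_two_iff_integrable_sq hq.aestronglyMeasurable).2 hq2)
  have hr1 : Integrable r γ := integrable_of_abs_le hrm T hrT
  have hY : ∀ u, |r u * g u| ≤ T := fun u => by
    rw [abs_mul]; exact (mul_le_mul (hrT u) (hg1 u) (abs_nonneg _) hT0.le).trans (by simp)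
  have hYi : Integrable (fun u => r u * g u) γ := integrable_of_abs_le (hrm.mul hg) T hY
  have hqg : Integrable (fun u => q u * g u) γ := hq1.mul_bdd (c := 1) hg.aestronglyMeasurable
    (ae_of_all _ hg1)
  set μT := ∫ u, r u * g u ∂γ with hμ
  have hμT : |μT| ≤ T := by
    have := norm_integral_le_of_norm_le_const (μ := γ)
      (f := fun u => r u * g u) (C := T) (ae_of_all _ hY)
    simpa using this
  have hbias : |μT - ∫ u, q u * g u ∂γ| ≤ M / T := by
    rw [hμ, ← integral_sub hYi hqg]
    calc _ ≤ ∫ u, |r u * g u - q u * g u| ∂γ := abs_integral_le_integral_abs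
      _ ≤ ∫ u, q u ^ 2 / T ∂γ := by
          refine integral_mono (hYi.sub hqg).abs (hq2.div_const _) fun u => ?_
          change |r u * g u - q u * g u| ≤ q u ^ 2 / T
          rw [← sub_mul, abs_mul, abs_sub_comm]
          exact (mul_le_mul (hdiff u) (hg1 u) (abs_nonneg _) (by positivity)).trans (by simp)
      _ = (∫ u, q u ^ 2 ∂γ) / T := integral_div _ _
      _ ≤ _ := by gcongr
  set ξ : Θ → ℝ := fun u => r u * g u - μT with hξdef
  have hξm : Measurable ξ := (hrm.mul hg).sub_const _
  have hξK : ∀ u, |ξ u| ≤ 2 * T := fun u => by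
    have := abs_sub (r u * g u) μT
    simp only [hξdef]; linarith [hY u]
  have hξ0 : ∫ u, ξ u ∂γ = 0 := by
    simp only [hξdef]
    rw [integral_sub hYi (integrable_const _)]
    simp [hμ]
  have hYsq : Integrable (fun u => (r u * g u) ^ 2) γ :=
    integrable_of_abs_le ((hrm.mul hg).pow_const 2) (T ^ 2) fun u => by
      rw [abs_pow]; exact pow_le_pow_left₀ (abs_nonneg _) (hY u) 2
  have hξ2 : ∫ u, ξ u ^ 2 ∂γ ≤ M := by
    have e : ∀ u, ξ u ^ 2 = (r u * g u) ^ 2 - 2 * μT * (r u * g u) + μT ^ 2 := fun u => by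
      simp only [hξdef]; ring
    simp_rw [e]
    rw [integral_add (by exact hYsq.sub (hYi.const_mul _)) (integrable_const _),
      integral_sub hYsq (hYi.const_mul _), integral_const_mul, ← hμ]
    have h1 : ∫ u, (r u * g u) ^ 2 ∂γ ≤ ∫ u, q u ^ 2 ∂γ := by
      refine integral_mono hYsq hq2 fun u => ?_
      change (r u * g u) ^ 2 ≤ q u ^ 2
      have : g u ^ 2 ≤ 1 := (sq_le_one_iff_abs_le_one _).2 (hg1 u)
      rw [mul_pow]
      nlinarith [hrq u, sq_nonneg (r u)]
    simp
    nlinarith [sq_nonneg μT]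
  obtain ⟨-, -, h4⟩ := moments_sum_pi hξm hξK hξ0 hξ2 D
  set B := μT - ∫ u, q u * g u ∂γ with hB
  have hSm : Measurable fun θ : Fin D → Θ => ∑ j, ξ (θ j) :=
    Finset.measurable_sum _ fun j _ => hξm.comp (measurable_pi_apply j)
  have hSb : ∀ θ : Fin D → Θ, |∑ j, ξ (θ j)| ≤ D * (2 * T) := fun θ => by
    refine (Finset.abs_sum_le_sum_abs _ _).trans ((Finset.sum_le_sum fun j _ => hξK (θ j)).trans ?_)
    simp
  have hS4 : Integrable (fun θ : Fin D → Θ => (∑ j, ξ (θ j)) ^ 4) (Measure.pi fun _ => γ) :=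
    integrable_of_abs_le (hSm.pow_const 4) ((D * (2 * T)) ^ 4) fun θ => by
      rw [abs_pow]; exact pow_le_pow_left₀ (abs_nonneg _) (hSb θ) 4
  have hpt : ∀ θ : Fin D → Θ, ((D : ℝ)⁻¹ * ∑ j, r (θ j) * g (θ j) - ∫ u, q u * g u ∂γ) ^ 4
      ≤ 8 * ((D : ℝ)⁻¹ ^ 4 * (∑ j, ξ (θ j)) ^ 4 + B ^ 4) := fun θ => by
    have e : (D : ℝ)⁻¹ * ∑ j, r (θ j) * g (θ j) - ∫ u, q u * g u ∂γ
        = (D : ℝ)⁻¹ * (∑ j, ξ (θ j)) + B := by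
      simp only [hξdef, hB, Finset.sum_sub_distrib]
      simp
      field_simp
      ring
    rw [e, ← mul_pow]
    set s := (D : ℝ)⁻¹ * (∑ j, ξ (θ j))
    nlinarith [sq_nonneg (s - B), sq_nonneg (s + B), sq_nonneg (s ^ 2 - B ^ 2),
      mul_nonneg (sq_nonneg (s - B)) (sq_nonneg (s + B)),
      mul_nonneg (sq_nonneg (s - B)) (sq_nonneg s), mul_nonneg (sq_nonneg (s - B)) (sq_nonneg B),
      mul_nonneg (sq_nonneg (s - B)) (sq_nonneg (s - B))]
  have hrhs : Integrable (fun θ : Fin D → Θ => 8 * ((D : ℝ)⁻¹ ^ 4 * (∑ j, ξ (θ j)) ^ 4 + B ^ 4))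
      (Measure.pi fun _ => γ) := ((hS4.const_mul _).add (integrable_const _)).const_mul _
  refine (integral_mono_of_nonneg (ae_of_all _ fun θ => by positivity) hrhs
    (ae_of_all _ hpt)).trans ?_
  rw [integral_const_mul, integral_add (hS4.const_mul _) (integrable_const _), integral_const_mul]
  have hB4 : B ^ 4 ≤ (M / D) ^ 2 := by
    have h1 : B ^ 2 ≤ (M / T) ^ 2 := sq_le_sq' (abs_le.1 hbias).1 (abs_le.1 hbias).2
    have h2 : (M / T) ^ 2 = M / D := by rw [div_pow, hTsq]; field_simp
    calc B ^ 4 = (B ^ 2) ^ 2 := by ring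
      _ ≤ (M / D) ^ 2 := by rw [← h2]; gcongr
  -- With `K = 2T` and `T² = MD` the fourth moment gives `4 + 3 = 7`; the bias adds 1, and `8 * (7 +
  -- 1) = 64`.
  have h4' : (D : ℝ)⁻¹ ^ 4 * ∫ θ : Fin D → Θ, (∑ j, ξ (θ j)) ^ 4 ∂(Measure.pi fun _ => γ)
      ≤ 7 * (M / D) ^ 2 := by
    calc _ ≤ (D : ℝ)⁻¹ ^ 4 * (D * ((2 * T) ^ 2 * M) + 3 * D ^ 2 * M ^ 2) := by gcongr
      _ = 7 * (M / D) ^ 2 := by rw [mul_pow, hTsq]; field_simp; ring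
  simp only [integral_const, probReal_univ, smul_eq_mul, one_mul]
  linarith

/-! ### Fluctuations over signs and initialization -/

instance isProbabilityMeasure_rademacher : IsProbabilityMeasure rademacher := by
  constructor
  simp only [rademacher, Measure.smul_apply, Measure.add_apply, measure_univ, smul_eq_mul]
  rw [one_add_one_eq_two]
  exact ENNReal.inv_mul_cancel (by simp) (by simp)

theorem integrable_rademacher (f : ℝ → ℝ) : Integrable f rademacher := by
  unfold rademacher
  refine Integrable.smul_measure ?_ (by simp)
  exact ((integrable_dirac (by simp)).add_measure (integrable_dirac (by simp)))

theorem integral_rademacher (f : ℝ → ℝ) :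
    ∫ a, f a ∂rademacher = (f 1 + f (-1)) / 2 := by
  unfold rademacher
  rw [integral_smul_measure, integral_add_measure (integrable_dirac (by simp))
    (integrable_dirac (by simp)), integral_dirac, integral_dirac]
  simp
  ring

/-- A sum of independent square integrable variables deviates from its mean by at most the sum of
the second moments, in mean square. -/
theorem integral_sum_sub_sq_le {m : ℕ} {Ω : Type*} [MeasurableSpace Ω] {μ : Measure Ω}
    [IsProbabilityMeasure μ] {X : Fin m → Ω → ℝ} (hX : ∀ r, MemLp (X r) 2 μ) :
    Integrable (fun ω : Fin m → Ω => (∑ r, X r (ω r) - ∑ r, ∫ u, X r u ∂μ) ^ 2)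
        (Measure.pi fun _ => μ) ∧
    ∫ ω : Fin m → Ω, (∑ r, X r (ω r) - ∑ r, ∫ u, X r u ∂μ) ^ 2 ∂(Measure.pi fun _ => μ)
      ≤ ∑ r, ∫ u, X r u ^ 2 ∂μ := by
  have hmem : ∀ r, MemLp (fun ω : Fin m → Ω => X r (ω r)) 2 (Measure.pi fun _ => μ) := fun r =>
    (hX r).comp_measurePreserving (measurePreserving_eval _ r)
  have hsum : MemLp (fun ω : Fin m → Ω => ∑ r, X r (ω r)) 2 (Measure.pi fun _ => μ) :=
    memLp_finsetSum _ fun r _ => hmem r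
  have hmean : ∫ ω : Fin m → Ω, ∑ r, X r (ω r) ∂(Measure.pi fun _ => μ) = ∑ r, ∫ u, X r u ∂μ := by
    rw [integral_finsetSum _ fun r _ => (hmem r).integrable one_le_two]
    exact Finset.sum_congr rfl fun r _ =>
      integral_comp_eval (μ := fun _ : Fin m => μ) (hX r).aestronglyMeasurable
  have hvar := variance_sum_pi (μ := fun _ : Fin m => μ) hX
  have e : (∑ r, fun ω : Fin m → Ω => X r (ω r)) = fun ω => ∑ r, X r (ω r) := by
    ext ω; simp
  rw [e, variance_eq_integral hsum.aestronglyMeasurable.aemeasurable, hmean] at hvar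
  refine ⟨(hsum.sub (memLp_const _)).integrable_sq, ?_⟩
  rw [hvar]
  exact Finset.sum_le_sum fun r _ => variance_le_expectation_sq (hX r).aestronglyMeasurable

section
variable {D m : ℕ}

/-- Averaging over the initialization, the model concentrates around half of its linear part. -/
theorem integral_init_sq_le (h : EuclideanSpace ℝ (Fin D)) (y : Fin m → ℝ)
    (hy : h = 0 → ∀ r, y r = 0) :
    Integrable (fun W : Fin m → EuclideanSpace ℝ (Fin D) =>
        (∑ r, y r * step (inner ℝ (W r) h) - ∑ r, y r / 2) ^ 2)
      (Measure.pi fun _ => stdGaussian _) ∧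
    ∫ W : Fin m → EuclideanSpace ℝ (Fin D),
      (∑ r, y r * step (inner ℝ (W r) h) - ∑ r, y r / 2) ^ 2 ∂(Measure.pi fun _ => stdGaussian _)
      ≤ ∑ r, y r ^ 2 / 2 := by
  have hm : Measurable fun w : EuclideanSpace ℝ (Fin D) => step (inner ℝ w h) :=
    measurable_step.comp (by fun_prop)
  have hX : ∀ r, MemLp (fun w : EuclideanSpace ℝ (Fin D) => y r * step (inner ℝ w h)) 2
      (stdGaussian _) := fun r =>
    (MemLp.of_bound hm.aestronglyMeasurable 1 (ae_of_all _ fun w => abs_step_le_one _)).const_mul _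
  have key := integral_sum_sub_sq_le hX
  have e1 : ∀ r, ∫ w, y r * step (inner ℝ w h) ∂(stdGaussian (EuclideanSpace ℝ (Fin D)))
      = y r / 2 := fun r => by
    -- At `h = 0` the gate is constantly 1 instead of having mean 1/2; the hypothesis on `y` removes
    -- these terms.
    by_cases h0 : h = 0
    · simp [hy h0 r]
    · rw [integral_const_mul, integral_step_inner h0]; ring
  have e2 : ∀ r, ∫ w, (y r * step (inner ℝ w h)) ^ 2 ∂(stdGaussian (EuclideanSpace ℝ (Fin D)))
      = y r ^ 2 / 2 := fun r => by
    by_cases h0 : h = 0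
    · simp [hy h0 r]
    · simp_rw [mul_pow, step_sq]
      rw [integral_const_mul, integral_step_inner h0]; ring
  simp_rw [e1, e2] at key
  exact key

/-- For a random sign the squares in `a (U + a V)²` cancel on average and only the cross term `2 U
V` survives: this is how the quadratic model multiplies. -/
theorem integral_sign_sq_le (U V : Fin m → ℝ) :
    Integrable (fun a : Fin m → ℝ => (∑ r, a r * (U r + a r * V r) ^ 2 - ∑ r, 2 * (U r * V r)) ^ 2)
      (Measure.pi fun _ => rademacher) ∧
    ∫ a : Fin m → ℝ, (∑ r, a r * (U r + a r * V r) ^ 2 - ∑ r, 2 * (U r * V r)) ^ 2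
        ∂(Measure.pi fun _ => rademacher)
      ≤ ∑ r, 4 * (U r ^ 4 + V r ^ 4) := by
  have hX : ∀ r, MemLp (fun a : ℝ => a * (U r + a * V r) ^ 2) 2 rademacher := fun r =>
    (memLp_two_iff_integrable_sq (by fun_prop)).2 (integrable_rademacher _)
  have key := integral_sum_sub_sq_le hX
  have e1 : ∀ r, ∫ a, a * (U r + a * V r) ^ 2 ∂rademacher = 2 * (U r * V r) := fun r => by
    rw [integral_rademacher]; ring
  simp_rw [e1] at key
  refine ⟨key.1, key.2.trans (Finset.sum_le_sum fun r _ => ?_)⟩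
  rw [integral_rademacher]
  nlinarith [sq_nonneg (U r ^ 2 - V r ^ 2)]

/-- The integrand is the gate variance bound of `integral_init_sq_le` for `y r = a r (U r + a r V
r)²`, here averaged over the signs. -/
theorem integral_sign_pow_four_le (U V : Fin m → ℝ) :
    Integrable (fun a : Fin m → ℝ => ∑ r, (a r * (U r + a r * V r) ^ 2) ^ 2 / 2)
      (Measure.pi fun _ => rademacher) ∧
    ∫ a : Fin m → ℝ, ∑ r, (a r * (U r + a r * V r) ^ 2) ^ 2 / 2
        ∂(Measure.pi fun _ => rademacher)
      ≤ ∑ r, 2 * (U r ^ 4 + V r ^ 4) := by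
  have hX : ∀ r, Integrable (fun a : ℝ => (a * (U r + a * V r) ^ 2) ^ 2 / 2) rademacher := fun r =>
    integrable_rademacher _
  have hX' : ∀ r, Integrable (fun a : Fin m → ℝ => (a r * (U r + a r * V r) ^ 2) ^ 2 / 2)
      (Measure.pi fun _ => rademacher) := fun r =>
    (measurePreserving_eval (fun _ : Fin m => rademacher) r).integrable_comp_of_integrable (hX r)
  refine ⟨integrable_finsetSum _ fun r _ => hX' r, ?_⟩
  rw [integral_finsetSum _ fun r _ => hX' r]
  refine Finset.sum_le_sum fun r _ => ?_
  rw [integral_comp_eval (μ := fun _ : Fin m => rademacher) (i := r)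
    (f := fun a : ℝ => (a * (U r + a * V r) ^ 2) ^ 2 / 2) (hX r).aestronglyMeasurable,
    integral_rademacher]
  nlinarith [sq_nonneg (U r ^ 2 - V r ^ 2)]

/-- Mean square error of the quadratic model over signs and initialization, when the `r`-th neuron
reads `U r + a r * V r`. -/
theorem lintegral_quadNTK_sub_sq_le (h : EuclideanSpace ℝ (Fin D)) (U V : Fin m → ℝ)
    (hh : h = 0 → ∀ r, U r = 0 ∧ V r = 0) :
    ∫⁻ a : Fin m → ℝ, ∫⁻ W : Fin m → EuclideanSpace ℝ (Fin D),
      ENNReal.ofReal ((1 / (2 * √m) * ∑ r, a r * step (inner ℝ (W r) h) * (U r + a r * V r) ^ 2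
        - 1 / (2 * √m) * ∑ r, U r * V r) ^ 2)
      ∂(Measure.pi fun _ => stdGaussian _) ∂(Measure.pi fun _ => rademacher)
    ≤ ENNReal.ofReal (2 / m * ∑ r, (U r ^ 4 + V r ^ 4)) := by
  obtain ⟨i1, b1⟩ := integral_sign_sq_le U V
  obtain ⟨i2, b2⟩ := integral_sign_pow_four_le U V
  have hcsq : (1 / (2 * √(m : ℝ))) ^ 2 = 1 / (4 * m) := by
    rw [div_pow, mul_pow, Real.sq_sqrt (Nat.cast_nonneg m)]; norm_num
  set C := 1 / (2 * √(m : ℝ)) with hC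
  set F : (Fin m → ℝ) → ℝ := fun a => 2 * (1 / (4 * m)) * (∑ r, (a r * (U r + a r * V r) ^ 2) ^ 2 / 2)
    + 1 / (8 * m) * (∑ r, a r * (U r + a r * V r) ^ 2 - ∑ r, 2 * (U r * V r)) ^ 2 with hF
  have hF0 : ∀ a, 0 ≤ F a := fun a => by simp only [hF]; positivity
  have hFi : Integrable F (Measure.pi fun _ => rademacher) := (i2.const_mul _).add (i1.const_mul _)
  have step1 : ∀ a : Fin m → ℝ, ∫⁻ W : Fin m → EuclideanSpace ℝ (Fin D),
      ENNReal.ofReal ((C * ∑ r, a r * step (inner ℝ (W r) h) * (U r + a r * V r) ^ 2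
        - C * ∑ r, U r * V r) ^ 2) ∂(Measure.pi fun _ => stdGaussian _) ≤ ENNReal.ofReal (F a) := by
    intro a
    obtain ⟨i3, b3⟩ := integral_init_sq_le h (fun r => a r * (U r + a r * V r) ^ 2)
      (fun h0 r => by simp [(hh h0 r).1, (hh h0 r).2])
    set Q := (∑ r, a r * (U r + a r * V r) ^ 2 - ∑ r, 2 * (U r * V r)) with hQ
    -- The error is split into the fluctuation of the gates at fixed signs and half the sign
    -- fluctuation `Q`.
    have hpt : ∀ W : Fin m → EuclideanSpace ℝ (Fin D),
        (C * ∑ r, a r * step (inner ℝ (W r) h) * (U r + a r * V r) ^ 2 - C * ∑ r, U r * V r) ^ 2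
        ≤ 2 * (1 / (4 * m)) * (∑ r, a r * (U r + a r * V r) ^ 2 * step (inner ℝ (W r) h) -
            ∑ r, a r * (U r + a r * V r) ^ 2 / 2) ^ 2 + 1 / (8 * m) * Q ^ 2 := by
      intro W
      have e1 : ∑ r, a r * step (inner ℝ (W r) h) * (U r + a r * V r) ^ 2
          = ∑ r, a r * (U r + a r * V r) ^ 2 * step (inner ℝ (W r) h) :=
        Finset.sum_congr rfl fun r _ => by ring
      have e2 : ∑ r, U r * V r = ∑ r, a r * (U r + a r * V r) ^ 2 / 2 - Q / 2 := by
        rw [hQ, ← Finset.sum_div, ← Finset.mul_sum]; ring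
      rw [e1, e2]
      set S := ∑ r, a r * (U r + a r * V r) ^ 2 * step (inner ℝ (W r) h)
      set A := ∑ r, a r * (U r + a r * V r) ^ 2 / 2
      calc (C * S - C * (A - Q / 2)) ^ 2 = C ^ 2 * ((S - A) + Q / 2) ^ 2 := by ring
        _ ≤ C ^ 2 * (2 * (S - A) ^ 2 + Q ^ 2 / 2) := by
            gcongr; nlinarith [sq_nonneg ((S - A) - Q / 2)]
        _ = _ := by rw [hcsq]; ring
    calc _ ≤ ∫⁻ W : Fin m → EuclideanSpace ℝ (Fin D), ENNReal.ofReal (2 * (1 / (4 * m)) *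
          (∑ r, a r * (U r + a r * V r) ^ 2 * step (inner ℝ (W r) h) -
            ∑ r, a r * (U r + a r * V r) ^ 2 / 2) ^ 2 + 1 / (8 * m) * Q ^ 2)
          ∂(Measure.pi fun _ => stdGaussian _) :=
          lintegral_mono fun W => ENNReal.ofReal_le_ofReal (hpt W)
      _ = ENNReal.ofReal (∫ W : Fin m → EuclideanSpace ℝ (Fin D), (2 * (1 / (4 * m)) *
          (∑ r, a r * (U r + a r * V r) ^ 2 * step (inner ℝ (W r) h) -
            ∑ r, a r * (U r + a r * V r) ^ 2 / 2) ^ 2 + 1 / (8 * m) * Q ^ 2)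
          ∂(Measure.pi fun _ => stdGaussian _)) := by
          rw [ofReal_integral_eq_lintegral_ofReal
            (by exact (i3.const_mul _).add (integrable_const _))]
          exact ae_of_all _ fun W => by positivity
      _ ≤ _ := by
          apply ENNReal.ofReal_le_ofReal
          rw [integral_add (i3.const_mul _) (integrable_const _), integral_const_mul]
          simp only [hF, integral_const, probReal_univ, smul_eq_mul, one_mul]
          gcongr
  calc _ ≤ ∫⁻ a : Fin m → ℝ, ENNReal.ofReal (F a) ∂(Measure.pi fun _ => rademacher) :=
        lintegral_mono step1
    _ = ENNReal.ofReal (∫ a, F a ∂(Measure.pi fun _ => rademacher)) := by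
        rw [ofReal_integral_eq_lintegral_ofReal hFi (ae_of_all _ hF0)]
    _ ≤ _ := by
        apply ENNReal.ofReal_le_ofReal
        simp only [hF]
        rw [integral_add (i2.const_mul _) (i1.const_mul _), integral_const_mul, integral_const_mul]
        have hs : (0 : ℝ) ≤ ∑ r, (U r ^ 4 + V r ^ 4) := Finset.sum_nonneg fun r _ => by positivity
        -- The gates contribute `1/m` and the signs `1/(2m)`.
        calc _ ≤ 2 * (1 / (4 * (m : ℝ))) * (∑ r, 2 * (U r ^ 4 + V r ^ 4))
              + 1 / (8 * (m : ℝ)) * ∑ r, 4 * (U r ^ 4 + V r ^ 4) := by gcongr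
          _ = 3 / 2 * (1 / m * ∑ r, (U r ^ 4 + V r ^ 4)) := by
              rw [← Finset.mul_sum, ← Finset.mul_sum, mul_comm 8 (m : ℝ), mul_comm 4 (m : ℝ)]
              simp only [one_div, mul_inv]; ring
          _ ≤ 2 * (1 / m * ∑ r, (U r ^ 4 + V r ^ 4)) := by gcongr; norm_num
          _ = _ := by ring

end

/-- The neurons can be split into `k` groups of comparable sizes. -/
theorem exists_balanced_labelling {k m : ℕ} (hk : 0 < k) (hkm : k ≤ m) :
    ∃ τ : Fin m → Fin k, ∀ s, (m : ℝ) ≤ 2 * k * (Finset.univ.filter fun r => τ r = s).card := by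
  -- Every residue class has at least `⌊m/k⌋` members, and `⌊m/k⌋ ≥ m/(2k)` because `k ≤ m`.
  refine ⟨fun r => ⟨r % k, Nat.mod_lt _ hk⟩, fun s => ?_⟩
  have hq : m / k ≤ (Finset.univ.filter fun r : Fin m => (⟨r % k, Nat.mod_lt _ hk⟩ : Fin k) = s).card := by
    have hlt : ∀ i, i < m / k → (s : ℕ) + k * i < m := fun i hi => by
      have h1 : k * (i + 1) ≤ k * (m / k) := Nat.mul_le_mul_left k hi
      have h2 := Nat.mul_div_le m k
      have := s.2
      rw [Nat.mul_add] at h1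
      omega
    calc m / k = (Finset.univ : Finset (Fin (m / k))).card := by simp
      _ ≤ _ := by
        refine Finset.card_le_card_of_injOn (fun i : Fin (m / k) => (⟨s + k * i, hlt i i.2⟩ : Fin m))
          (fun i _ => ?_) (fun i _ j _ hij => ?_)
        · simp [Nat.add_mul_mod_self_left, Nat.mod_eq_of_lt s.2]
        · have : (s : ℕ) + k * i = s + k * j := by simpa using hij
          exact Fin.ext (Nat.eq_of_mul_eq_mul_left hk (by omega))
  have hdiv : m ≤ 2 * k * (m / k) := by
    have h1 : 1 ≤ m / k := (Nat.one_le_div_iff hk).2 hkm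
    have h2 := Nat.div_add_mod m k
    have h3 := Nat.mod_lt m hk
    nlinarith
  exact_mod_cast hdiv.trans (Nat.mul_le_mul_left _ hq)

/-! ### Products of two read-outs -/

/-- With `a = u - x` and `b = v - y`, `uv - xy = x b + y a + a b`. Young's inequalities with weights
tuned to `R` and `S` give, after integration, the same second moments `8R`, `8S`, `64RS` as
Cauchy–Schwarz. -/
theorem integral_mul_sub_mul_sq_le {Ω : Type*} [MeasurableSpace Ω] {μ : Measure Ω}
    [IsProbabilityMeasure μ] {u v : Ω → ℝ} (hu : Measurable u) (hv : Measurable v) {K L : ℝ}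
    (hK : ∀ ω, |u ω| ≤ K) (hL : ∀ ω, |v ω| ≤ L) {x y R S : ℝ} (hR : 0 < R) (hS : 0 < S)
    (hx : ∫ ω, (u ω - x) ^ 4 ∂μ ≤ 64 * R ^ 2) (hy : ∫ ω, (v ω - y) ^ 4 ∂μ ≤ 64 * S ^ 2) :
    ∫ ω, (u ω * v ω - x * y) ^ 2 ∂μ ≤ 24 * (x ^ 2 * S + y ^ 2 * R + 8 * (R * S)) ∧
    ∫ ω, (u ω ^ 4 + v ω ^ 4) ∂μ ≤ 8 * (x ^ 4 + y ^ 4 + 64 * R ^ 2 + 64 * S ^ 2) := by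
  have hux : Integrable (fun ω => (u ω - x) ^ 4) μ :=
    integrable_of_abs_le ((hu.sub_const x).pow_const 4) ((K + |x|) ^ 4) fun ω => by
      rw [abs_pow]
      exact pow_le_pow_left₀ (abs_nonneg _) ((abs_sub _ _).trans (by gcongr; exact hK ω)) 4
  have hvy : Integrable (fun ω => (v ω - y) ^ 4) μ :=
    integrable_of_abs_le ((hv.sub_const y).pow_const 4) ((L + |y|) ^ 4) fun ω => by
      rw [abs_pow]
      exact pow_le_pow_left₀ (abs_nonneg _) ((abs_sub _ _).trans (by gcongr; exact hL ω)) 4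
  have hgen : ∀ (c₀ c₁ c₂ : ℝ), 0 ≤ c₁ → 0 ≤ c₂ → ∀ f : Ω → ℝ, (∀ ω, 0 ≤ f ω) →
      (∀ ω, f ω ≤ c₀ + c₁ * (u ω - x) ^ 4 + c₂ * (v ω - y) ^ 4) →
      ∫ ω, f ω ∂μ ≤ c₀ + c₁ * (64 * R ^ 2) + c₂ * (64 * S ^ 2) := by
    intro c₀ c₁ c₂ h1 h2 f hf0 hf
    have i1 : Integrable (fun ω => c₀ + c₁ * (u ω - x) ^ 4) μ :=
      (integrable_const _).add (hux.const_mul _)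
    refine (integral_mono_of_nonneg (ae_of_all _ hf0) (i1.add (hvy.const_mul c₂))
      (ae_of_all _ hf)).trans ?_
    rw [integral_add' i1 (hvy.const_mul c₂), integral_add (integrable_const _) (hux.const_mul _),
      integral_const_mul, integral_const_mul]
    simp only [integral_const, probReal_univ, smul_eq_mul, one_mul]
    gcongr
  constructor
  · refine (hgen (12 * (x ^ 2 * S + y ^ 2 * R)) (3 * (y ^ 2 / (16 * R) + S / (2 * R)))
      (3 * (x ^ 2 / (16 * S) + R / (2 * S))) (by positivity) (by positivity) _
      (fun ω => sq_nonneg _) fun ω => ?_).trans (le_of_eq (by field_simp; ring))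
    set a := u ω - x with ha
    set b := v ω - y with hb
    have e : u ω * v ω - x * y = x * b + y * a + a * b := by rw [ha, hb]; ring
    have h1 : (x * b + y * a + a * b) ^ 2 ≤ 3 * (x ^ 2 * b ^ 2 + y ^ 2 * a ^ 2 + a ^ 2 * b ^ 2) := by
      nlinarith [sq_nonneg (x * b - y * a), sq_nonneg (x * b - a * b), sq_nonneg (y * a - a * b)]
    have h2 : b ^ 2 ≤ 4 * S + b ^ 4 / (16 * S) := by
      rw [← sub_nonneg]
      have : 4 * S + b ^ 4 / (16 * S) - b ^ 2 = (b ^ 2 - 8 * S) ^ 2 / (16 * S) := by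
        field_simp; ring
      rw [this]; positivity
    have h3 : a ^ 2 ≤ 4 * R + a ^ 4 / (16 * R) := by
      rw [← sub_nonneg]
      have : 4 * R + a ^ 4 / (16 * R) - a ^ 2 = (a ^ 2 - 8 * R) ^ 2 / (16 * R) := by
        field_simp; ring
      rw [this]; positivity
    have h4 : a ^ 2 * b ^ 2 ≤ S / (2 * R) * a ^ 4 + R / (2 * S) * b ^ 4 := by
      rw [← sub_nonneg]
      have : S / (2 * R) * a ^ 4 + R / (2 * S) * b ^ 4 - a ^ 2 * b ^ 2
          = (S * a ^ 2 - R * b ^ 2) ^ 2 / (2 * R * S) := by field_simp; ring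
      rw [this]; positivity
    rw [e]
    have h5 := mul_le_mul_of_nonneg_left h2 (sq_nonneg x)
    have h6 := mul_le_mul_of_nonneg_left h3 (sq_nonneg y)
    calc _ ≤ 3 * (x ^ 2 * (4 * S + b ^ 4 / (16 * S)) + y ^ 2 * (4 * R + a ^ 4 / (16 * R))
          + (S / (2 * R) * a ^ 4 + R / (2 * S) * b ^ 4)) := by linarith
      _ = _ := by ring
  · have h4 : ∀ s t : ℝ, s ^ 4 ≤ 8 * (t ^ 4 + (s - t) ^ 4) := fun s t => by
      have h1 : s ^ 2 ≤ 2 * (t ^ 2 + (s - t) ^ 2) := by nlinarith [sq_nonneg (t - (s - t))]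
      have h2 := pow_le_pow_left₀ (sq_nonneg s) h1 2
      nlinarith [sq_nonneg (t ^ 2 - (s - t) ^ 2)]
    refine (hgen (8 * (x ^ 4 + y ^ 4)) 8 8 (by norm_num) (by norm_num) _
      (fun ω => by positivity) fun ω => ?_).trans (le_of_eq (by ring))
    linarith [h4 (u ω) x, h4 (v ω) y]

/-- The linear read-out `D⁻¹ ∑ⱼ r(θⱼ) g(x)ⱼ` of the random features. -/
noncomputable def readout {d D : ℕ} (r : EuclideanSpace ℝ (Fin d) × ℝ → ℝ) (θ : FeatParam d D) (x : Input d) : ℝ :=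
  (D : ℝ)⁻¹ * ∑ j, r (θ j) * feature θ x j

theorem feature_eq_step {d D : ℕ} (θ : FeatParam d D) (x : Input d) (j : Fin D) :
    feature θ x j = step (inner ℝ (θ j).1 (x : EuclideanSpace ℝ (Fin d)) + (θ j).2) := rfl

theorem measurable_feature {Ω : Type*} [MeasurableSpace Ω] {d D : ℕ} {f : Ω → FeatParam d D}
    {g : Ω → Input d} (hf : Measurable f) (hg : Measurable g) :
    Measurable fun ω => feature (f ω) (g ω) := by
  refine measurable_pi_lambda _ fun j => ?_
  simp only [feature_eq_step]
  have h1 : Measurable fun ω => f ω j := (measurable_pi_apply j).comp hf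
  have h2 : Measurable fun ω => (g ω : EuclideanSpace ℝ (Fin d)) := measurable_subtype_coe.comp hg
  exact measurable_step.comp ((h1.fst.inner h2).add h1.snd)

theorem measurable_readout {Ω : Type*} [MeasurableSpace Ω] {d D : ℕ} {f : Ω → FeatParam d D}
    {g : Ω → Input d} (hf : Measurable f) (hg : Measurable g)
    {r : EuclideanSpace ℝ (Fin d) × ℝ → ℝ} (hr : Measurable r) :
    Measurable fun ω => readout r (f ω) (g ω) :=
  measurable_const.mul (Finset.measurable_sum _ fun j _ =>
    (hr.comp ((measurable_pi_apply j).comp hf)).mul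
      ((measurable_pi_apply j).comp (measurable_feature hf hg)))

theorem abs_readout_le {d D : ℕ} {r : EuclideanSpace ℝ (Fin d) × ℝ → ℝ} {T : ℝ}
    (hT : ∀ u, |r u| ≤ T) (θ : FeatParam d D) (x : Input d) :
    |readout r θ x| ≤ (D : ℝ)⁻¹ * (D * T) := by
  unfold readout
  rw [abs_mul, abs_of_nonneg (by positivity : (0 : ℝ) ≤ (D : ℝ)⁻¹)]
  gcongr
  refine (Finset.abs_sum_le_sum_abs _ _).trans ((Finset.sum_le_sum (g := fun _ => T) fun j _ => ?_).trans ?_)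
  · rw [abs_mul, feature_eq_step]
    have := mul_le_mul (hT (θ j)) (abs_step_le_one
      (inner ℝ (θ j).1 (x : EuclideanSpace ℝ (Fin d)) + (θ j).2)) (abs_nonneg _)
      ((abs_nonneg _).trans (hT (θ j)))
    linarith
  · simp

/-- The law of the random features. -/
noncomputable def featLaw (d D : ℕ) : Measure (FeatParam d D) :=
  Measure.pi fun _ : Fin D => (stdGaussian (EuclideanSpace ℝ (Fin d))).prod (gaussianReal 0 1)

instance (d D : ℕ) : IsProbabilityMeasure (featLaw d D) := by unfold featLaw; infer_instance

theorem exists_readout_pow {d D : ℕ} (hD : 0 < D) (β : EuclideanSpace ℝ (Fin d)) (n : ℕ) {M : ℝ}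
    (hM0 : 0 < M) (hM : 200 * ((max n 1 : ℕ) : ℝ) ^ 3 * ‖β‖ ^ (2 * n) ≤ M) :
    ∃ r : EuclideanSpace ℝ (Fin d) × ℝ → ℝ, Measurable r ∧ (∃ T, ∀ u, |r u| ≤ T) ∧
      ∀ x : Input d, ∫ θ, (readout r θ x - inner ℝ β (x : EuclideanSpace ℝ (Fin d)) ^ n) ^ 4
        ∂(featLaw d D) ≤ 64 * (M / D) ^ 2 := by
  obtain ⟨q, hq, hq2, hqM, hqx⟩ := exists_feature_coeff β n
  obtain ⟨r, hr, hT, h⟩ := exists_truncated_coeff hq hq2 hM0 (hqM.trans hM) hD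
  refine ⟨r, hr, hT, fun x => ?_⟩
  have := h (fun u => step (inner ℝ u.1 (x : EuclideanSpace ℝ (Fin d)) + u.2))
    (measurable_step.comp (by fun_prop)) (fun u => abs_step_le_one _)
  rw [hqx x (by simp)] at this
  exact this

theorem ceil_half (p : ℕ) : ⌈(p : ℝ) / 2⌉₊ = (p + 1) / 2 := by
  apply le_antisymm
  · rw [Nat.ceil_le, div_le_iff₀ two_pos]
    exact_mod_cast (by omega : p ≤ (p + 1) / 2 * 2)
  · have h : (p : ℝ) / 2 ≤ ⌈(p : ℝ) / 2⌉₊ := Nat.le_ceil _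
    rw [div_le_iff₀ two_pos] at h
    have : p ≤ ⌈(p : ℝ) / 2⌉₊ * 2 := by exact_mod_cast h
    omega

theorem sq_pow_le_one_add (z : ℝ) {n p : ℕ} (hn : n ≤ p) : (z ^ 2) ^ n ≤ 1 + z ^ (2 * p) := by
  rw [pow_mul]
  have h0 : 0 ≤ (z ^ 2) ^ p := by positivity
  rcases le_total (z ^ 2) 1 with h | h
  · have := pow_le_one₀ (n := n) (sq_nonneg z) h
    linarith
  · have := pow_le_pow_right₀ h hn
    linarith

/-- The delicate term is the higher power times the rate `S` of the lower one. For `B ≥ 1` the rate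
`S` is the smaller one; for `B ≤ 1` the higher power is itself at most `B ^ ⌈p/2⌉`. So `R` governs
everything, and only `‖β‖ ^ (2⌈p/2⌉)` enters the width. The constant is `240 = 24 (1 + 1 + 8)`. -/
theorem product_rate_le (p : ℕ) {z B R S : ℝ} (hzB : |z| ≤ B) (hR : 0 < R) (hS : 0 < S)
    (hSR : 1 ≤ B → S ≤ R) (hSB : B ≤ 1 → B ^ (2 * ((p + 1) / 2)) * S ≤ R) (hS1 : S ≤ 1) :
    24 * ((z ^ ((p + 1) / 2)) ^ 2 * S + (z ^ (p / 2)) ^ 2 * R + 8 * (R * S))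
      ≤ 240 * (R * (1 + z ^ (2 * p))) := by
  have hzp : 0 ≤ z ^ (2 * p) := by rw [pow_mul]; positivity
  have hz2 : z ^ 2 ≤ B ^ 2 := sq_le_sq' (abs_le.1 hzB).1 (abs_le.1 hzB).2
  have t1 : (z ^ ((p + 1) / 2)) ^ 2 * S ≤ R * (1 + z ^ (2 * p)) := by
    rw [pow_right_comm]
    rcases le_total 1 B with h | h
    · rw [mul_comm]
      exact mul_le_mul (hSR h) (sq_pow_le_one_add z (by omega)) (by positivity) hR.le
    · calc (z ^ 2) ^ ((p + 1) / 2) * S ≤ (B ^ 2) ^ ((p + 1) / 2) * S := by gcongr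
        _ = B ^ (2 * ((p + 1) / 2)) * S := by rw [pow_mul]
        _ ≤ R := hSB h
        _ ≤ _ := le_mul_of_one_le_right hR.le (by linarith)
  have t2 : (z ^ (p / 2)) ^ 2 * R ≤ R * (1 + z ^ (2 * p)) := by
    rw [pow_right_comm, mul_comm]
    exact mul_le_mul_of_nonneg_left (sq_pow_le_one_add z (by omega)) hR.le
  have t3 : R * S ≤ R * (1 + z ^ (2 * p)) := mul_le_mul_of_nonneg_left (by linarith) hR.le
  linarith

/-- The only degree above `2p` is `2p + 2`, for the higher factor with `p` odd; the surplus `z² ≤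
B²` is paid by the factor `1 + B ^ (2⌈p/2⌉)`. The constant is `1040 = 8 (1 + 1 + 64 + 64)`. -/
theorem product_size_le (p : ℕ) {z B R S : ℝ} (hzB : |z| ≤ B) (hR : 0 < R) (hS : 0 < S)
    (hR1 : R ≤ 1) (hS1 : S ≤ 1) :
    8 * ((z ^ ((p + 1) / 2)) ^ 4 + (z ^ (p / 2)) ^ 4 + 64 * R ^ 2 + 64 * S ^ 2)
      ≤ 1040 * ((1 + B ^ (2 * ((p + 1) / 2))) * (1 + z ^ (2 * p))) := by
  have hB0 : 0 ≤ B := (abs_nonneg z).trans hzB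
  have hzp : 0 ≤ z ^ (2 * p) := by rw [pow_mul]; positivity
  have hz2 : z ^ 2 ≤ B ^ 2 := sq_le_sq' (abs_le.1 hzB).1 (abs_le.1 hzB).2
  have hBa : 0 ≤ B ^ (2 * ((p + 1) / 2)) := by positivity
  have t7 : 1 + z ^ (2 * p) ≤ (1 + B ^ (2 * ((p + 1) / 2))) * (1 + z ^ (2 * p)) :=
    le_mul_of_one_le_left (by linarith) (by linarith)
  have t1 : (z ^ ((p + 1) / 2)) ^ 4 ≤ (1 + B ^ (2 * ((p + 1) / 2))) * (1 + z ^ (2 * p)) := by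
    rcases Nat.even_or_odd p with hp | hp
    · have : (p + 1) / 2 * 4 = 2 * p := by obtain ⟨l, rfl⟩ := hp; omega
      rw [← pow_mul, this]
      linarith
    · have h4 : (p + 1) / 2 * 4 = 2 * p + 2 := by obtain ⟨l, rfl⟩ := hp; omega
      have h6 : 2 ≤ 2 * ((p + 1) / 2) := by obtain ⟨l, rfl⟩ := hp; omega
      rw [← pow_mul, h4, pow_add]
      have h5 : B ^ 2 ≤ 1 + B ^ (2 * ((p + 1) / 2)) := by
        rcases le_total B 1 with h | h
        · have := pow_le_one₀ (n := 2) hB0 h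
          linarith
        · have := pow_le_pow_right₀ h h6
          linarith
      rw [mul_comm]
      exact mul_le_mul (hz2.trans h5) (by linarith) hzp (by positivity)
  have t2 : (z ^ (p / 2)) ^ 4 ≤ 1 + z ^ (2 * p) := by
    have : (z ^ (p / 2)) ^ 4 = (z ^ 2) ^ (2 * (p / 2)) := by rw [← pow_mul, ← pow_mul]; ring_nf
    rw [this]
    exact sq_pow_le_one_add z (by omega)
  have t4 : R ^ 2 ≤ 1 := pow_le_one₀ hR.le hR1
  have t5 : S ^ 2 ≤ 1 := pow_le_one₀ hS.le hS1
  linarith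

/-- Power functions with a norm that is not tiny are approximated by products of two read-outs;
the others are small. -/
theorem exists_readout_product {d D k : ℕ} (hD : 0 < D) (hk : 0 < k) (β : EuclideanSpace ℝ (Fin d))
    (p : ℕ) {ε δ : ℝ} (hε : 0 < ε) (hε1 : ε < 1) (hδ : 0 < δ) (hδ1 : δ < 1)
    (hDs : 10000 * (k : ℝ) ^ 3 * (((max p 1 : ℕ) : ℝ) ^ 5 * ‖β‖ ^ (2 * ((p + 1) / 2)))
      ≤ ε ^ 2 * δ * D) :
    ∃ r₁ r₂ : EuclideanSpace ℝ (Fin d) × ℝ → ℝ, Measurable r₁ ∧ Measurable r₂ ∧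
      (∃ T, ∀ u, |r₁ u| ≤ T) ∧ (∃ T, ∀ u, |r₂ u| ≤ T) ∧
      ∀ x : Input d,
        ∫ θ, (readout r₁ θ x * readout r₂ θ x - if ε < ‖β‖ ^ ((p + 1) / 2) then
            inner ℝ β (x : EuclideanSpace ℝ (Fin d)) ^ p else 0) ^ 2 ∂(featLaw d D)
          ≤ 5 * ε ^ 2 * δ / k ^ 3 * (1 + inner ℝ β (x : EuclideanSpace ℝ (Fin d)) ^ (2 * p)) ∧
        ∫ θ, (readout r₁ θ x ^ 4 + readout r₂ θ x ^ 4) ∂(featLaw d D)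
          ≤ δ * D / (4 * k ^ 3) * (1 + inner ℝ β (x : EuclideanSpace ℝ (Fin d)) ^ (2 * p)) := by
  have hD' : (0 : ℝ) < D := by exact_mod_cast hD
  have hk' : (1 : ℝ) ≤ k := by exact_mod_cast hk
  have hk3 : (1 : ℝ) ≤ (k : ℝ) ^ 3 := one_le_pow₀ hk'
  have hz0 : ∀ x : Input d, 0 ≤ inner ℝ β (x : EuclideanSpace ℝ (Fin d)) ^ (2 * p) := fun x => by
    rw [pow_mul]; positivity
  -- Dropped monomials get zero read-outs. For the kept ones the lower bound on `‖β‖` makes the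
  -- width large compared with both rates.
  by_cases hkeep : ε < ‖β‖ ^ ((p + 1) / 2)
  swap
  · refine ⟨fun _ => 0, fun _ => 0, measurable_const, measurable_const, ⟨0, by simp⟩, ⟨0, by simp⟩,
      fun x => ?_⟩
    have := hz0 x
    simp only [readout, hkeep, if_false, zero_mul, Finset.sum_const_zero, mul_zero, sub_zero]
    constructor
    · simp; positivity
    · simp; positivity
  simp only [hkeep, if_true]
  set a := (p + 1) / 2 with ha
  set b := p / 2 with hb
  have hab : a + b = p := by omega
  set B := ‖β‖ with hB
  have hB0 : 0 ≤ B := norm_nonneg _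
  set Q : ℝ := ((max p 1 : ℕ) : ℝ) ^ 5 with hQ
  have hmax1 : (1 : ℝ) ≤ ((max p 1 : ℕ) : ℝ) := by exact_mod_cast le_max_right p 1
  have hQ1 : 1 ≤ Q := one_le_pow₀ hmax1
  have hmaxle : ∀ n ≤ p, ((max n 1 : ℕ) : ℝ) ^ 3 ≤ Q := fun n hn => by
    calc ((max n 1 : ℕ) : ℝ) ^ 3 ≤ ((max p 1 : ℕ) : ℝ) ^ 3 := by gcongr
      _ ≤ Q := pow_le_pow_right₀ hmax1 (by norm_num)
  have hBa : 0 < B ^ a := hε.trans hkeep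
  have hBb : 0 < B ^ b := by
    rcases hB0.lt_or_eq with h | h
    · positivity
    · have : a = 0 := by
        by_contra h0
        rw [← h, zero_pow h0] at hBa
        exact lt_irrefl _ hBa
      have : b = 0 := by omega
      rw [this]; simp
  have hBa2 : B ^ (2 * a) = (B ^ a) ^ 2 := by rw [mul_comm, pow_mul]
  have hBb2 : B ^ (2 * b) = (B ^ b) ^ 2 := by rw [mul_comm, pow_mul]
  have hBa2pos : 0 < B ^ (2 * a) := by rw [hBa2]; positivity
  have hBb2pos : 0 < B ^ (2 * b) := by rw [hBb2]; positivity
  have hBaε : ε ^ 2 ≤ B ^ (2 * a) := by rw [hBa2]; gcongr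
  obtain ⟨r₁, hr₁, ⟨T₁, hT₁⟩, h₁⟩ := exists_readout_pow hD β a (M := 200 * Q * B ^ (2 * a))
    (by positivity) (by gcongr; exact hmaxle a (by omega))
  obtain ⟨r₂, hr₂, ⟨T₂, hT₂⟩, h₂⟩ := exists_readout_pow hD β b (M := 200 * Q * B ^ (2 * b))
    (by positivity) (by gcongr; exact hmaxle b (by omega))
  refine ⟨r₁, r₂, hr₁, hr₂, ⟨T₁, hT₁⟩, ⟨T₂, hT₂⟩, fun x => ?_⟩
  set R := 200 * Q * B ^ (2 * a) / D with hR
  set S := 200 * Q * B ^ (2 * b) / D with hS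
  have hR0 : 0 < R := by positivity
  have hS0 : 0 < S := by positivity
  set z : ℝ := inner ℝ β (x : EuclideanSpace ℝ (Fin d)) with hz
  have hzB : |z| ≤ B := by
    have := abs_real_inner_le_norm β (x : EuclideanSpace ℝ (Fin d))
    rwa [show ‖(x : EuclideanSpace ℝ (Fin d))‖ = 1 by simp, mul_one] at this
  have hzp : 0 ≤ z ^ (2 * p) := hz0 x
  have hRle : R ≤ ε ^ 2 * δ / (50 * k ^ 3) := by
    rw [hR, div_le_div_iff₀ hD' (by positivity)]
    nlinarith
  have hε2 : ε ^ 2 ≤ 1 := pow_le_one₀ hε.le hε1.le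
  -- Since the monomial is kept, `ε² ≤ B ^ (2a)`, so `ε²` cancels and a width bound free of `B`
  -- remains; it is needed for `S ≤ 1` when `B < 1`.
  have hDQ : 10000 * (k : ℝ) ^ 3 * Q ≤ δ * D := by
    have h1 : ε ^ 2 * (10000 * (k : ℝ) ^ 3 * Q) ≤ ε ^ 2 * (δ * D) := by
      calc _ = 10000 * (k : ℝ) ^ 3 * (Q * ε ^ 2) := by ring
        _ ≤ 10000 * (k : ℝ) ^ 3 * (Q * B ^ (2 * a)) := by gcongr
        _ ≤ _ := by linarith
    exact le_of_mul_le_mul_left h1 (by positivity)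
  have hR1 : R ≤ 1 := by
    refine hRle.trans ?_
    rw [div_le_one (by positivity)]
    nlinarith [mul_le_one₀ hε2 hδ.le hδ1.le]
  have hSR : 1 ≤ B → S ≤ R := fun h => by
    rw [hR, hS]; gcongr; omega
  have hS1 : S ≤ 1 := by
    rcases le_total 1 B with h | h
    · exact (hSR h).trans hR1
    · rw [hS, div_le_one hD']
      have : B ^ (2 * b) ≤ 1 := pow_le_one₀ hB0 h
      have hDD : δ * D ≤ D := by nlinarith
      nlinarith
  obtain ⟨e1, e2⟩ := integral_mul_sub_mul_sq_le (μ := featLaw d D)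
    (measurable_readout measurable_id (measurable_const (a := x)) hr₁)
    (measurable_readout measurable_id (measurable_const (a := x)) hr₂)
    (fun θ => abs_readout_le hT₁ θ x) (fun θ => abs_readout_le hT₂ θ x) hR0 hS0 (h₁ x) (h₂ x)
  rw [← pow_add, hab] at e1
  constructor
  · refine (e1.trans (product_rate_le p hzB hR0 hS0 hSR (fun h => ?_) hS1)).trans ?_
    · have : B ^ (2 * b) ≤ 1 := pow_le_one₀ hB0 h
      have h4 : S ≤ 200 * Q / D := by
        rw [hS]
        exact div_le_div_of_nonneg_right (mul_le_of_le_one_right (by positivity) this) hD'.le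
      calc B ^ (2 * a) * S ≤ B ^ (2 * a) * (200 * Q / D) := by gcongr
        _ = R := by rw [hR]; ring
    · calc _ ≤ 240 * (ε ^ 2 * δ / (50 * k ^ 3) * (1 + z ^ (2 * p))) := by gcongr
        _ = 24 / 5 * (ε ^ 2 * δ / k ^ 3) * (1 + z ^ (2 * p)) := by field_simp; norm_num
        _ ≤ 5 * (ε ^ 2 * δ / k ^ 3) * (1 + z ^ (2 * p)) := by gcongr; norm_num
        _ = _ := by ring
  · refine (e2.trans (product_size_le p hzB hR0 hS0 hR1 hS1)).trans ?_
    have t3 : 1 + B ^ (2 * a) ≤ δ * D / (5000 * k ^ 3) := by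
      rw [le_div_iff₀ (by positivity)]
      have h1 : 10000 * (k : ℝ) ^ 3 * B ^ (2 * a) ≤ δ * D := by
        calc 10000 * (k : ℝ) ^ 3 * B ^ (2 * a) ≤ 10000 * (k : ℝ) ^ 3 * (Q * B ^ (2 * a)) := by
              gcongr; exact le_mul_of_one_le_left hBa2pos.le hQ1
          _ ≤ ε ^ 2 * δ * D := hDs
          _ ≤ 1 * δ * D := by gcongr
          _ = _ := by ring
      have h2 : 10000 * (k : ℝ) ^ 3 ≤ δ * D :=
        le_trans (le_mul_of_one_le_right (by positivity) hQ1) hDQ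
      linarith
    calc _ ≤ 1040 * (δ * D / (5000 * k ^ 3) * (1 + z ^ (2 * p))) := by gcongr
      _ = 208 / 1000 * (δ * D / k ^ 3) * (1 + z ^ (2 * p)) := by field_simp; norm_num
      _ ≤ 1 / 4 * (δ * D / k ^ 3) * (1 + z ^ (2 * p)) := by
        refine mul_le_mul_of_nonneg_right (mul_le_mul_of_nonneg_right ?_ (by positivity))
          (by positivity)
        norm_num
      _ = _ := by field_simp

/-! ### The whitened representation -/

/-- Feature vectors lie in `{0,1}^D`, so the representation depends on finitely many patterns and is
measurable without any regularity of the matrix square root or inverse. -/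
theorem measurable_comp_of_finite_range {Ω S S' : Type*} [MeasurableSpace Ω] [MeasurableSpace S]
    [MeasurableSingletonClass S] [MeasurableSpace S'] {f : Ω → S} (hf : Measurable f)
    (hfin : (Set.range f).Finite) (F : S → S') : Measurable fun ω => F (f ω) := by
  intro A _
  have h : (fun ω => F (f ω)) ⁻¹' A = f ⁻¹' (F ⁻¹' A ∩ Set.range f) := by
    ext ω; simp
  rw [h]
  exact hf (hfin.subset Set.inter_subset_right).measurableSet

theorem feature_mem {d D : ℕ} (θ : FeatParam d D) (x : Input d) :
    feature θ x ∈ Set.pi Set.univ fun _ : Fin D => ({0, 1} : Set ℝ) := fun j _ => by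
  unfold feature; split_ifs <;> simp

/-- The empirical covariance as a function of the feature vectors of the sample. -/
noncomputable def patternCov {D n₀ : ℕ} (φ : Fin n₀ → Fin D → ℝ) : Matrix (Fin D) (Fin D) ℝ :=
  (n₀ : ℝ)⁻¹ • ∑ i, Matrix.vecMulVec (φ i) (φ i)

open Classical in
/-- The whitened representation where it is defined, the plain features elsewhere. -/
noncomputable def patternRep {D n₀ : ℕ} (φ : Fin n₀ → Fin D → ℝ) (g : Fin D → ℝ) :
    EuclideanSpace ℝ (Fin D) :=
  if (patternCov φ).PosDef then WithLp.toLp 2 (((CFC.sqrt (patternCov φ))⁻¹).mulVec g)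
  -- Any choice that vanishes only when `g` does would serve: it lets second moments be integrated
  -- over all outcomes, degenerate ones included.
  else WithLp.toLp 2 g

/-- The representation of an input, extended to degenerate samples. -/
noncomputable def rep {d D n₀ : ℕ} (θ : FeatParam d D) (X : Fin n₀ → Input d) (x : Input d) :
    EuclideanSpace ℝ (Fin D) :=
  patternRep (fun i => feature θ (X i)) (feature θ x)

theorem rep_eq_whitened {d D n₀ : ℕ} {θ : FeatParam d D} {X : Fin n₀ → Input d}
    (h : (empCov θ X).PosDef) (x : Input d) : rep θ X x = whitened θ X x := if_pos h

theorem measurable_rep {Ω : Type*} [MeasurableSpace Ω] {d D n₀ : ℕ} {f : Ω → FeatParam d D}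
    {X : Ω → Fin n₀ → Input d} {g : Ω → Input d} (hf : Measurable f) (hX : Measurable X)
    (hg : Measurable g) : Measurable fun ω => rep (f ω) (X ω) (g ω) := by
  have h1 : Measurable fun ω => fun i => feature (f ω) (X ω i) :=
    measurable_pi_lambda _ fun i => measurable_feature hf ((measurable_pi_apply i).comp hX)
  have h2 : Measurable fun ω => feature (f ω) (g ω) := measurable_feature hf hg
  have hcube : (Set.pi Set.univ fun _ : Fin D => ({0, 1} : Set ℝ)).Finite :=
    Set.Finite.pi fun _ => Set.toFinite _
  have hfin : (Set.range fun ω => ((fun i => feature (f ω) (X ω i)), feature (f ω) (g ω))).Finite := by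
    refine ((Set.Finite.pi (t := fun _ : Fin n₀ => Set.pi Set.univ fun _ : Fin D => ({0, 1} : Set ℝ))
      fun _ => hcube).prod hcube).subset ?_
    rintro _ ⟨ω, rfl⟩
    exact ⟨fun i _ => feature_mem _ _, feature_mem _ _⟩
  exact measurable_comp_of_finite_range (h1.prodMk h2) hfin fun w => patternRep w.1 w.2

theorem isUnit_det_sqrt {D : ℕ} {S : Matrix (Fin D) (Fin D) ℝ} (hS : S.PosDef) :
    IsUnit (CFC.sqrt S).det := by
  have h : CFC.sqrt S * CFC.sqrt S = S :=
    CFC.sqrt_mul_sqrt_self S (Matrix.nonneg_iff_posSemidef.2 hS.posSemidef)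
  rw [isUnit_iff_ne_zero]
  intro h0
  have := hS.det_pos
  rw [← h, Matrix.det_mul, h0] at this
  simp at this

/-- The gates have mean 1/2 only at a nonzero representation. At the remaining inputs all read-outs
vanish, so the gates do not matter there. -/
theorem feature_eq_zero_of_rep_eq_zero {d D n₀ : ℕ} {θ : FeatParam d D} {X : Fin n₀ → Input d}
    {x : Input d} (h : rep θ X x = 0) : feature θ x = 0 := by
  unfold rep patternRep at h
  split_ifs at h with hp
  · have h1 : ((CFC.sqrt (patternCov fun i => feature θ (X i)))⁻¹).mulVec (feature θ x) = 0 := by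
      simpa using h
    have h2 := congrArg (CFC.sqrt (patternCov fun i => feature θ (X i))).mulVec h1
    rwa [Matrix.mulVec_mulVec, Matrix.mul_nonsing_inv _ (isUnit_det_sqrt hp), Matrix.one_mulVec,
      Matrix.mulVec_zero] at h2
  · simpa using h

/-- The square root is symmetric, so it crosses the inner product and cancels the whitening. -/
theorem inner_sqrt_mulVec_whitened {d D n₀ : ℕ} {θ : FeatParam d D} {X : Fin n₀ → Input d}
    (h : (empCov θ X).PosDef) (u : Fin D → ℝ) (x : Input d) :
    inner ℝ (WithLp.toLp 2 ((CFC.sqrt (empCov θ X)).mulVec u) : EuclideanSpace ℝ (Fin D))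
      (whitened θ X x) = ∑ j, u j * feature θ x j := by
  set S := CFC.sqrt (empCov θ X) with hS
  have hsymm : S.transpose = S := by
    have : S.PosSemidef := Matrix.nonneg_iff_posSemidef.1 (CFC.sqrt_nonneg _)
    simpa using this.isHermitian.eq
  rw [EuclideanSpace.inner_eq_star_dotProduct]
  change (S⁻¹.mulVec (feature θ x)) ⬝ᵥ star (S.mulVec u) = _
  rw [star_trivial, Matrix.dotProduct_mulVec, ← Matrix.mulVec_transpose, hsymm,
    Matrix.mulVec_mulVec, Matrix.mul_nonsing_inv _ (isUnit_det_sqrt h), Matrix.one_mulVec]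
  simp [dotProduct, mul_comm]

theorem readout_eq_zero_of_rep_eq_zero {d D n₀ : ℕ} {θ : FeatParam d D} {X : Fin n₀ → Input d}
    {x : Input d} (h : rep θ X x = 0) (r : EuclideanSpace ℝ (Fin d) × ℝ → ℝ) :
    readout r θ x = 0 := by
  simp [readout, feature_eq_zero_of_rep_eq_zero h]

/-- Scales for the groups of neurons which make the mean of the model correct. -/
theorem exists_group_scale {k m : ℕ} (hm : 0 < m) {τ : Fin m → Fin k}
    (hτ : ∀ s, (m : ℝ) ≤ 2 * k * (Finset.univ.filter fun r => τ r = s).card) :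
    ∃ c : Fin k → ℝ, (∀ u v : Fin k → ℝ,
        1 / (2 * √m) * ∑ r, (c (τ r) * u (τ r)) * (c (τ r) * v (τ r)) = ∑ s, u s * v s) ∧
      ∀ u : Fin k → ℝ, ∑ r, (c (τ r) * u (τ r)) ^ 4 ≤ 8 * k * ∑ s, u s ^ 4 := by
  have hm' : (0 : ℝ) < m := by exact_mod_cast hm
  have hsm : 0 < √(m : ℝ) := Real.sqrt_pos.2 hm'
  have hsm2 : √(m : ℝ) ^ 2 = m := Real.sq_sqrt hm'.le
  set N : Fin k → ℝ := fun s => ((Finset.univ.filter fun r => τ r = s).card : ℝ) with hN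
  have hk : ∀ _ : Fin k, (0 : ℝ) < k := fun s => by exact_mod_cast (Fin.pos s)
  have hN0 : ∀ s, 0 < N s := fun s => by
    have h1 : 0 < 2 * k * N s := hm'.trans_le (hτ s)
    exact pos_of_mul_pos_right h1 (by positivity)
  have hsum : ∀ f : Fin k → ℝ, ∑ r, f (τ r) = ∑ s, N s * f s := fun f => by
    rw [← Finset.sum_fiberwise' Finset.univ τ f]
    simp [hN]
  have hc2 : ∀ s, √(2 * √m / N s) ^ 2 = 2 * √m / N s := fun s =>
    Real.sq_sqrt (by have := hN0 s; positivity)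
  -- The `N s` neurons of a group contribute `N s * c s ^ 2 / (2√m)` times the product, which fixes
  -- `c s`. Balance then gives `N s * c s ^ 4 = 4m / N s ≤ 8k`.
  refine ⟨fun s => √(2 * √m / N s), fun u v => ?_, fun u => ?_⟩
  · rw [hsum fun s => (√(2 * √m / N s) * u s) * (√(2 * √m / N s) * v s), Finset.mul_sum]
    refine Finset.sum_congr rfl fun s _ => ?_
    have := (hN0 s).ne'
    calc _ = 1 / (2 * √m) * (N s * (√(2 * √m / N s) ^ 2 * (u s * v s))) := by ring
      _ = u s * v s := by rw [hc2]; field_simp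
  · rw [hsum fun s => (√(2 * √m / N s) * u s) ^ 4, Finset.mul_sum]
    refine Finset.sum_le_sum fun s _ => ?_
    have h1 := hN0 s
    have h2 : N s * √(2 * √m / N s) ^ 4 ≤ 8 * k := by
      have e : √(2 * √m / N s) ^ 4 = 4 * m / N s ^ 2 := by
        rw [show √(2 * √m / N s) ^ 4 = (√(2 * √m / N s) ^ 2) ^ 2 by ring, hc2, div_pow, mul_pow,
          hsm2]
        norm_num
      rw [e]
      have : N s * (4 * m / N s ^ 2) = 4 * m / N s := by field_simp
      rw [this, div_le_iff₀ h1]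
      linarith [hτ s]
    calc N s * (√(2 * √m / N s) * u s) ^ 4 = (N s * √(2 * √m / N s) ^ 4) * u s ^ 4 := by ring
      _ ≤ 8 * k * u s ^ 4 := by gcongr

theorem eLpNorm_two_le_iff {Ω : Type*} [MeasurableSpace Ω] {μ : Measure Ω} (f : Ω → ℝ) {C : ℝ}
    (hC : 0 ≤ C) :
    eLpNorm f 2 μ ≤ ENNReal.ofReal C ↔
      ∫⁻ ω, ENNReal.ofReal (f ω ^ 2) ∂μ ≤ ENNReal.ofReal (C ^ 2) := by
  rw [eLpNorm_eq_lintegral_rpow_enorm_toReal (by simp) (by simp)]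
  simp only [ENNReal.toReal_ofNat]
  rw [one_div, ENNReal.rpow_inv_le_iff two_pos, ENNReal.ofReal_pow hC]
  have : ∀ ω, ‖f ω‖ₑ ^ (2 : ℝ) = ENNReal.ofReal (f ω ^ 2) := fun ω => by
    rw [← sq_abs, ← Real.norm_eq_abs, ENNReal.ofReal_pow (norm_nonneg _), ofReal_norm]
    exact_mod_cast rfl
  simp_rw [this]
  norm_cast

/-! ### Mean square error of the assembled model -/

section
variable {d D n₀ m k : ℕ}

/-- The model with the neurons `c_{τ r} (û_{τ r} + a_r v̂_{τ r})`, written through read-outs. -/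
noncomputable def readoutModel (r₁ r₂ : Fin k → EuclideanSpace ℝ (Fin d) × ℝ → ℝ)
    (α c : Fin k → ℝ) (τ : Fin m → Fin k) (ω : Outcome d D n₀ m) (x : Input d) : ℝ :=
  1 / (2 * √m) * ∑ r, ω.2.2.1 r * step (inner ℝ (ω.2.2.2 r) (rep ω.1 ω.2.1 x)) *
    (c (τ r) * readout (r₁ (τ r)) ω.1 x
      + ω.2.2.1 r * (c (τ r) * (α (τ r) * readout (r₂ (τ r)) ω.1 x))) ^ 2

theorem measurable_readoutModel {r₁ r₂ : Fin k → EuclideanSpace ℝ (Fin d) × ℝ → ℝ}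
    (h₁ : ∀ s, Measurable (r₁ s)) (h₂ : ∀ s, Measurable (r₂ s)) (α c : Fin k → ℝ)
    (τ : Fin m → Fin k) {Ω : Type*} [MeasurableSpace Ω] {f : Ω → Outcome d D n₀ m}
    {g : Ω → Input d} (hf : Measurable f) (hg : Measurable g) :
    Measurable fun ω => readoutModel r₁ r₂ α c τ (f ω) (g ω) := by
  have hθ : Measurable fun ω => (f ω).1 := hf.fst
  have hX : Measurable fun ω => (f ω).2.1 := hf.snd.fst
  have ha : ∀ r, Measurable fun ω => (f ω).2.2.1 r := fun r =>
    (measurable_pi_apply r).comp hf.snd.snd.fst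
  have hW : ∀ r, Measurable fun ω => (f ω).2.2.2 r := fun r =>
    (measurable_pi_apply r).comp hf.snd.snd.snd
  have hrep : Measurable fun ω => rep (f ω).1 (f ω).2.1 (g ω) := measurable_rep hθ hX hg
  have hs : ∀ r, Measurable fun ω => step (inner ℝ ((f ω).2.2.2 r) (rep (f ω).1 (f ω).2.1 (g ω))) :=
    fun r => measurable_step.comp ((hW r).inner hrep)
  have hu : ∀ s, Measurable fun ω => readout (r₁ s) (f ω).1 (g ω) := fun s =>
    measurable_readout hθ hg (h₁ s)
  have hv : ∀ s, Measurable fun ω => readout (r₂ s) (f ω).1 (g ω) := fun s =>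
    measurable_readout hθ hg (h₂ s)
  unfold readoutModel
  exact measurable_const.mul (Finset.measurable_sum _ fun r _ => ((ha r).mul (hs r)).mul
    (((measurable_const.mul (hu (τ r))).add ((ha r).mul (measurable_const.mul
      (measurable_const.mul (hv (τ r)))))).pow_const 2))

/-- Integrating out signs and initialization. -/
theorem lintegral_readoutModel_sub_sq_le (hm : 0 < m)
    (r₁ r₂ : Fin k → EuclideanSpace ℝ (Fin d) × ℝ → ℝ) {α c : Fin k → ℝ} (hα : ∀ s, |α s| ≤ 1)
    {τ : Fin m → Fin k}
    (hc : ∀ u v : Fin k → ℝ,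
      1 / (2 * √m) * ∑ r, (c (τ r) * u (τ r)) * (c (τ r) * v (τ r)) = ∑ s, u s * v s)
    (hc4 : ∀ u : Fin k → ℝ, ∑ r, (c (τ r) * u (τ r)) ^ 4 ≤ 8 * k * ∑ s, u s ^ 4)
    (θ : FeatParam d D) (X : Fin n₀ → Input d) (x : Input d) (G : Fin k → ℝ) :
    ∫⁻ a, ∫⁻ W, ENNReal.ofReal ((readoutModel r₁ r₂ α c τ (θ, X, a, W) x - ∑ s, α s * G s) ^ 2)
      ∂(Measure.pi fun _ : Fin m => stdGaussian (EuclideanSpace ℝ (Fin D)))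
      ∂(Measure.pi fun _ : Fin m => rademacher)
    ≤ ENNReal.ofReal (∑ s, (32 * k / m * (readout (r₁ s) θ x ^ 4 + readout (r₂ s) θ x ^ 4)
        + 2 * k * (readout (r₁ s) θ x * readout (r₂ s) θ x - G s) ^ 2)) := by
  set u : Fin k → ℝ := fun s => readout (r₁ s) θ x with hu
  set v : Fin k → ℝ := fun s => readout (r₂ s) θ x with hv
  have hmean := hc u fun s => α s * v s
  have key := lintegral_quadNTK_sub_sq_le (rep θ X x) (fun r => c (τ r) * u (τ r))
    (fun r => c (τ r) * (α (τ r) * v (τ r))) (fun h r => by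
      simp [hu, hv, readout_eq_zero_of_rep_eq_zero h])
  rw [hmean] at key
  -- `t` is the error of the read-out products, which involves neither signs nor gates.
  set t := ∑ s, u s * (α s * v s) - ∑ s, α s * G s with ht
  have hpt : ∀ y : ℝ, ENNReal.ofReal ((y - ∑ s, α s * G s) ^ 2)
      ≤ 2 * ENNReal.ofReal ((y - ∑ s, u s * (α s * v s)) ^ 2) + ENNReal.ofReal (2 * t ^ 2) := by
    intro y
    have h2 : (2 : ℝ≥0∞) = ENNReal.ofReal 2 := by simp
    rw [h2, ← ENNReal.ofReal_mul two_pos.le, ← ENNReal.ofReal_add (by positivity) (by positivity)]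
    apply ENNReal.ofReal_le_ofReal
    rw [ht]
    nlinarith [sq_nonneg ((y - ∑ s, u s * (α s * v s)) -
      (∑ s, u s * (α s * v s) - ∑ s, α s * G s))]
  have hU : (0 : ℝ) ≤ 2 / m * ∑ r, ((c (τ r) * u (τ r)) ^ 4 + (c (τ r) * (α (τ r) * v (τ r))) ^ 4) := by
    positivity
  calc _ ≤ ∫⁻ a, ∫⁻ W, (2 * ENNReal.ofReal ((readoutModel r₁ r₂ α c τ (θ, X, a, W) x -
          ∑ s, u s * (α s * v s)) ^ 2) + ENNReal.ofReal (2 * t ^ 2))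
        ∂(Measure.pi fun _ : Fin m => stdGaussian (EuclideanSpace ℝ (Fin D)))
        ∂(Measure.pi fun _ : Fin m => rademacher) :=
        lintegral_mono fun a => lintegral_mono fun W => hpt _
    _ = 2 * (∫⁻ a, ∫⁻ W, ENNReal.ofReal ((readoutModel r₁ r₂ α c τ (θ, X, a, W) x -
          ∑ s, u s * (α s * v s)) ^ 2)
        ∂(Measure.pi fun _ : Fin m => stdGaussian (EuclideanSpace ℝ (Fin D)))
        ∂(Measure.pi fun _ : Fin m => rademacher)) + ENNReal.ofReal (2 * t ^ 2) := by
        simp_rw [lintegral_add_right _ measurable_const]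
        rw [← lintegral_const_mul' _ _ (by simp)]
        simp_rw [lintegral_const_mul' (2 : ℝ≥0∞) _ (by simp)]
        simp
    _ ≤ 2 * ENNReal.ofReal (2 / m * ∑ r, ((c (τ r) * u (τ r)) ^ 4 +
          (c (τ r) * (α (τ r) * v (τ r))) ^ 4)) + ENNReal.ofReal (2 * t ^ 2) := by
        gcongr
        exact key
    _ = ENNReal.ofReal (2 * (2 / m * ∑ r, ((c (τ r) * u (τ r)) ^ 4 +
          (c (τ r) * (α (τ r) * v (τ r))) ^ 4)) + 2 * t ^ 2) := by
        rw [ENNReal.ofReal_add (by positivity) (by positivity), ENNReal.ofReal_mul two_pos.le]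
        simp
    _ ≤ _ := by
        apply ENNReal.ofReal_le_ofReal
        have h1 := hc4 u
        have h2 := hc4 fun s => α s * v s
        have hα2 : ∀ s, α s ^ 2 ≤ 1 := fun s => (sq_le_one_iff_abs_le_one _).2 (hα s)
        have h3 : ∑ s, (α s * v s) ^ 4 ≤ ∑ s, v s ^ 4 := Finset.sum_le_sum fun s _ => by
          have h4 : α s ^ 4 ≤ 1 := by
            rw [show α s ^ 4 = (α s ^ 2) ^ 2 by ring]
            exact pow_le_one₀ (sq_nonneg _) (hα2 s)
          rw [mul_pow]
          exact mul_le_of_le_one_left (by positivity) h4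
        have h5 : t ^ 2 ≤ k * ∑ s, (u s * v s - G s) ^ 2 := by
          have e : t = ∑ s, α s * (u s * v s - G s) := by
            rw [ht, ← Finset.sum_sub_distrib]
            exact Finset.sum_congr rfl fun s _ => by ring
          have h6 := sq_sum_le_card_mul_sum_sq (s := Finset.univ)
            (f := fun s => α s * (u s * v s - G s))
          rw [Finset.card_univ, Fintype.card_fin] at h6
          rw [e]
          refine h6.trans ?_
          refine mul_le_mul_of_nonneg_left (Finset.sum_le_sum fun s _ => ?_) (Nat.cast_nonneg k)
          rw [mul_pow]
          exact mul_le_of_le_one_left (sq_nonneg _) (hα2 s)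
        have hk0 : (0 : ℝ) ≤ k := Nat.cast_nonneg k
        have hm0 : (0 : ℝ) < m := by exact_mod_cast hm
        rw [Finset.sum_add_distrib, Finset.sum_add_distrib, ← Finset.mul_sum, ← Finset.mul_sum,
          Finset.sum_add_distrib]
        have h7 : 8 * k * ∑ s, (α s * v s) ^ 4 ≤ 8 * k * ∑ s, v s ^ 4 := by gcongr
        calc 2 * (2 / m * (∑ r, (c (τ r) * u (τ r)) ^ 4 +
              ∑ r, (c (τ r) * (α (τ r) * v (τ r))) ^ 4)) + 2 * t ^ 2
            ≤ 2 * (2 / m * (8 * k * ∑ s, u s ^ 4 + 8 * k * ∑ s, v s ^ 4)) +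
              2 * (k * ∑ s, (u s * v s - G s) ^ 2) := by
              gcongr
              exact h2.trans h7
          _ = _ := by ring

theorem lintegral_jointLaw (P : Measure (Input d)) [IsProbabilityMeasure P]
    {F : Outcome d D n₀ m → ℝ≥0∞} (hF : Measurable F) :
    ∫⁻ ω, F ω ∂(jointLaw D n₀ m P) = ∫⁻ θ, ∫⁻ X, ∫⁻ a, ∫⁻ W, F (θ, X, a, W)
      ∂(Measure.pi fun _ : Fin m => stdGaussian (EuclideanSpace ℝ (Fin D)))
      ∂(Measure.pi fun _ : Fin m => rademacher) ∂(Measure.pi fun _ : Fin n₀ => P)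
      ∂(featLaw d D) := by
  have h1 : ∀ θ : FeatParam d D, Measurable fun w : (Fin n₀ → Input d) × (Fin m → ℝ) ×
      (Fin m → EuclideanSpace ℝ (Fin D)) => F (θ, w) := fun θ => hF.comp measurable_prodMk_left
  have h2 : ∀ (θ : FeatParam d D) (X : Fin n₀ → Input d), Measurable fun w : (Fin m → ℝ) ×
      (Fin m → EuclideanSpace ℝ (Fin D)) => F (θ, X, w) := fun θ X =>
    (h1 θ).comp measurable_prodMk_left
  unfold jointLaw
  rw [lintegral_prod _ hF.aemeasurable]
  refine lintegral_congr fun θ => ?_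
  rw [lintegral_prod _ (h1 θ).aemeasurable]
  refine lintegral_congr fun X => ?_
  rw [lintegral_prod _ (h2 θ X).aemeasurable]

/-- The mean square error over all the randomness. -/
theorem lintegral_error_le (P : Measure (Input d)) [IsProbabilityMeasure P] (hm : 0 < m)
    {r₁ r₂ : Fin k → EuclideanSpace ℝ (Fin d) × ℝ → ℝ} (h₁ : ∀ s, Measurable (r₁ s))
    (h₂ : ∀ s, Measurable (r₂ s)) (hb₁ : ∀ s, ∃ T, ∀ u, |r₁ s u| ≤ T)
    (hb₂ : ∀ s, ∃ T, ∀ u, |r₂ s u| ≤ T) {α c : Fin k → ℝ} (hα : ∀ s, |α s| ≤ 1)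
    {τ : Fin m → Fin k}
    (hc : ∀ u v : Fin k → ℝ,
      1 / (2 * √m) * ∑ r, (c (τ r) * u (τ r)) * (c (τ r) * v (τ r)) = ∑ s, u s * v s)
    (hc4 : ∀ u : Fin k → ℝ, ∑ r, (c (τ r) * u (τ r)) ^ 4 ≤ 8 * k * ∑ s, u s ^ 4)
    {G ρ : Fin k → Input d → ℝ} (hG : ∀ s, Measurable (G s)) {A B : ℝ} (hA : 0 ≤ A) (hB : 0 ≤ B)
    (hρ0 : ∀ s x, 0 ≤ ρ s x) (hρi : ∀ s, Integrable (ρ s) P) (hρ : ∀ s, ∫ x, ρ s x ∂P ≤ 2)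
    (hprod : ∀ s x, ∫ θ, (readout (r₁ s) θ x * readout (r₂ s) θ x - G s x) ^ 2 ∂(featLaw d D)
      ≤ A * ρ s x)
    (hsize : ∀ s x, ∫ θ, (readout (r₁ s) θ x ^ 4 + readout (r₂ s) θ x ^ 4) ∂(featLaw d D)
      ≤ B * ρ s x) :
    ∫⁻ ω, ∫⁻ x, ENNReal.ofReal ((readoutModel r₁ r₂ α c τ ω x - ∑ s, α s * G s x) ^ 2) ∂P
      ∂(jointLaw D n₀ m P) ≤ ENNReal.ofReal (2 * k * (32 * k / m * B + 2 * k * A)) := by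
  have hmeas : Measurable fun z : Outcome d D n₀ m × Input d =>
      ENNReal.ofReal ((readoutModel r₁ r₂ α c τ z.1 z.2 - ∑ s, α s * G s z.2) ^ 2) :=
    ENNReal.measurable_ofReal.comp
      (((measurable_readoutModel h₁ h₂ α c τ measurable_fst measurable_snd).sub
        (Finset.measurable_sum _ fun s _ => measurable_const.mul
          ((hG s).comp measurable_snd))).pow_const 2)
  have : IsProbabilityMeasure (jointLaw D n₀ m P) := by unfold jointLaw; infer_instance
  -- The Monte Carlo bounds hold at each fixed input, so the input is averaged last, against the
  -- weights `ρ`.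
  rw [lintegral_lintegral_swap hmeas.aemeasurable]
  set κ : ℝ := 32 * k / m * B + 2 * k * A with hκ
  have hκ0 : 0 ≤ κ := by positivity
  have hx : ∀ x, ∫⁻ ω, ENNReal.ofReal ((readoutModel r₁ r₂ α c τ ω x - ∑ s, α s * G s x) ^ 2)
      ∂(jointLaw D n₀ m P) ≤ ENNReal.ofReal (κ * ∑ s, ρ s x) := by
    intro x
    have hmx : Measurable fun ω : Outcome d D n₀ m =>
        ENNReal.ofReal ((readoutModel r₁ r₂ α c τ ω x - ∑ s, α s * G s x) ^ 2) :=
      ENNReal.measurable_ofReal.comp (((measurable_readoutModel h₁ h₂ α c τ measurable_id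
        (measurable_const (a := x))).sub_const _).pow_const 2)
    rw [lintegral_jointLaw P hmx]
    set Ξ : Fin k → FeatParam d D → ℝ := fun s θ =>
      32 * k / m * (readout (r₁ s) θ x ^ 4 + readout (r₂ s) θ x ^ 4)
        + 2 * k * (readout (r₁ s) θ x * readout (r₂ s) θ x - G s x) ^ 2 with hΞ
    have hΞ0 : ∀ s θ, 0 ≤ Ξ s θ := fun s θ => by simp only [hΞ]; positivity
    have hm1 : ∀ s, Measurable fun θ : FeatParam d D => readout (r₁ s) θ x := fun s =>
      measurable_readout measurable_id (measurable_const (a := x)) (h₁ s)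
    have hm2 : ∀ s, Measurable fun θ : FeatParam d D => readout (r₂ s) θ x := fun s =>
      measurable_readout measurable_id (measurable_const (a := x)) (h₂ s)
    have hi1 : ∀ s, Integrable (fun θ => readout (r₁ s) θ x ^ 4 + readout (r₂ s) θ x ^ 4)
        (featLaw d D) := fun s => by
      obtain ⟨T₁, hT₁⟩ := hb₁ s
      obtain ⟨T₂, hT₂⟩ := hb₂ s
      refine (integrable_of_abs_le ((hm1 s).pow_const 4) (((D : ℝ)⁻¹ * (D * T₁)) ^ 4)
        fun θ => ?_).add (integrable_of_abs_le ((hm2 s).pow_const 4) (((D : ℝ)⁻¹ * (D * T₂)) ^ 4)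
        fun θ => ?_)
      · rw [abs_pow]
        exact pow_le_pow_left₀ (abs_nonneg _) (abs_readout_le hT₁ θ x) 4
      · rw [abs_pow]
        exact pow_le_pow_left₀ (abs_nonneg _) (abs_readout_le hT₂ θ x) 4
    have hi2 : ∀ s, Integrable (fun θ => (readout (r₁ s) θ x * readout (r₂ s) θ x - G s x) ^ 2)
        (featLaw d D) := fun s => by
      obtain ⟨T₁, hT₁⟩ := hb₁ s
      obtain ⟨T₂, hT₂⟩ := hb₂ s
      refine integrable_of_abs_le ((((hm1 s).mul (hm2 s)).sub_const _).pow_const 2)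
        ((((D : ℝ)⁻¹ * (D * T₁)) * ((D : ℝ)⁻¹ * (D * T₂)) + |G s x|) ^ 2) fun θ => ?_
      rw [abs_pow]
      refine pow_le_pow_left₀ (abs_nonneg _) ((abs_sub _ _).trans ?_) 2
      rw [abs_mul]
      have h3 := abs_readout_le hT₁ θ x
      have h4 := abs_readout_le hT₂ θ x
      have h5 := mul_le_mul h3 h4 (abs_nonneg _) ((abs_nonneg _).trans h3)
      linarith
    have hΞi : ∀ s, Integrable (Ξ s) (featLaw d D) := fun s =>
      ((hi1 s).const_mul _).add ((hi2 s).const_mul _)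
    calc _ ≤ ∫⁻ θ, ENNReal.ofReal (∑ s, Ξ s θ) ∂(featLaw d D) := by
          refine lintegral_mono fun θ => ?_
          calc _ ≤ ∫⁻ _ : Fin n₀ → Input d, ENNReal.ofReal (∑ s, Ξ s θ)
                ∂(Measure.pi fun _ => P) :=
                lintegral_mono fun X =>
                  lintegral_readoutModel_sub_sq_le hm r₁ r₂ hα hc hc4 θ X x fun s => G s x
            _ = _ := by simp
      _ = ENNReal.ofReal (∫ θ, ∑ s, Ξ s θ ∂(featLaw d D)) := by
          rw [ofReal_integral_eq_lintegral_ofReal (integrable_finsetSum _ fun s _ => hΞi s)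
            (ae_of_all _ fun θ => Finset.sum_nonneg fun s _ => hΞ0 s θ)]
      _ ≤ _ := by
          apply ENNReal.ofReal_le_ofReal
          rw [integral_finsetSum _ fun s _ => hΞi s, Finset.mul_sum]
          refine Finset.sum_le_sum fun s _ => ?_
          simp only [hΞ]
          rw [integral_add ((hi1 s).const_mul _) ((hi2 s).const_mul _), integral_const_mul,
            integral_const_mul]
          calc _ ≤ 32 * k / m * (B * ρ s x) + 2 * k * (A * ρ s x) := by
                gcongr
                · exact hsize s x
                · exact hprod s x
            _ = κ * ρ s x := by rw [hκ]; ring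
  refine (lintegral_mono hx).trans ?_
  have hρsum : Integrable (fun x => κ * ∑ s, ρ s x) P :=
    (integrable_finsetSum _ fun s _ => hρi s).const_mul κ
  rw [← ofReal_integral_eq_lintegral_ofReal hρsum
    (ae_of_all _ fun x => mul_nonneg hκ0 (Finset.sum_nonneg fun s _ => hρ0 s x))]
  apply ENNReal.ofReal_le_ofReal
  rw [integral_const_mul, integral_finsetSum _ fun s _ => hρi s]
  calc κ * ∑ s, ∫ x, ρ s x ∂P ≤ κ * ∑ _s : Fin k, 2 := by gcongr with s; exact hρ s
    _ = 2 * k * κ := by simp; ring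

end

/-! ### Dropped monomials, the weights, and the constants -/

theorem abs_inner_input_le {d : ℕ} (β : EuclideanSpace ℝ (Fin d)) (x : Input d) :
    |inner ℝ β (x : EuclideanSpace ℝ (Fin d))| ≤ ‖β‖ := by
  have := abs_real_inner_le_norm β (x : EuclideanSpace ℝ (Fin d))
  rwa [show ‖(x : EuclideanSpace ℝ (Fin d))‖ = 1 by simp, mul_one] at this

theorem measurable_inner_input {d : ℕ} (β : EuclideanSpace ℝ (Fin d)) :
    Measurable fun x : Input d => inner ℝ β (x : EuclideanSpace ℝ (Fin d)) :=
  measurable_const.inner measurable_subtype_coe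

/-- Justifies dropping a monomial: `ε < 1` forces `B ≤ 1`, and then the full power of `B` is no
larger than the half power. -/
theorem abs_pow_le_of_pow_half_le {z B ε : ℝ} {p : ℕ} (hz : |z| ≤ B) (hε1 : ε < 1)
    (h : B ^ ((p + 1) / 2) ≤ ε) : |z ^ p| ≤ ε := by
  have hB0 : 0 ≤ B := (abs_nonneg z).trans hz
  have hB1 : B ≤ 1 := by
    by_contra h1
    have := one_le_pow₀ (n := (p + 1) / 2) (not_le.1 h1).le
    linarith
  rw [abs_pow]
  calc |z| ^ p ≤ B ^ p := pow_le_pow_left₀ (abs_nonneg _) hz p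
    _ ≤ B ^ ((p + 1) / 2) := pow_le_pow_of_le_one hB0 hB1 (by omega)
    _ ≤ ε := h

theorem eLpNorm_le_of_abs_le {Ω : Type*} [MeasurableSpace Ω] {μ : Measure Ω}
    [IsProbabilityMeasure μ] {f : Ω → ℝ} {C : ℝ} (h : ∀ ω, |f ω| ≤ C) :
    eLpNorm f 2 μ ≤ ENNReal.ofReal C := by
  have := eLpNorm_le_of_ae_bound (p := 2) (μ := μ) (f := f) (C := C) (ae_of_all _ h)
  simpa using this

/-- The normalisation of the monomials in `L²` turns the pointwise error weight `1 + z ^ (2p)` into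
the constant 2. -/
theorem integral_one_add_pow_le {d : ℕ} (P : Measure (Input d)) [IsProbabilityMeasure P]
    (β : EuclideanSpace ℝ (Fin d)) (p : ℕ)
    (h : eLpNorm (fun x : Input d => inner ℝ β (x : EuclideanSpace ℝ (Fin d)) ^ p) 2 P ≤ 1) :
    Integrable (fun x : Input d => 1 + inner ℝ β (x : EuclideanSpace ℝ (Fin d)) ^ (2 * p)) P ∧
    ∫ x : Input d, (1 + inner ℝ β (x : EuclideanSpace ℝ (Fin d)) ^ (2 * p)) ∂P ≤ 2 := by
  have hi : Integrable (fun x : Input d => inner ℝ β (x : EuclideanSpace ℝ (Fin d)) ^ (2 * p)) P :=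
    integrable_of_abs_le ((measurable_inner_input β).pow_const _) (‖β‖ ^ (2 * p)) fun x => by
      rw [abs_pow]; exact pow_le_pow_left₀ (abs_nonneg _) (abs_inner_input_le β x) _
  refine ⟨(integrable_const _).add hi, ?_⟩
  have h1 := (eLpNorm_two_le_iff _ zero_le_one).1 (h.trans_eq ENNReal.ofReal_one.symm)
  simp_rw [← pow_mul, mul_comm p 2] at h1
  rw [← ofReal_integral_eq_lintegral_ofReal hi (ae_of_all _ fun x => by
    change 0 ≤ inner ℝ β (x : EuclideanSpace ℝ (Fin d)) ^ (2 * p); rw [pow_mul]; positivity),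
    ENNReal.ofReal_le_ofReal_iff (by norm_num)] at h1
  rw [integral_add (integrable_const _) hi]
  simp
  linarith

theorem quadNTK_zero {D m : ℕ} (a : Fin m → ℝ) (W₀ : Fin m → EuclideanSpace ℝ (Fin D))
    (h : EuclideanSpace ℝ (Fin D)) : quadNTK a W₀ (fun _ => 0) h = 0 := by
  simp [quadNTK]

/-- The weights which realise `readoutModel`. -/
noncomputable def starWeights {d D n₀ m k : ℕ}
    (r₁ r₂ : Fin k → EuclideanSpace ℝ (Fin d) × ℝ → ℝ) (α c : Fin k → ℝ) (τ : Fin m → Fin k)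
    (θ : FeatParam d D) (X : Fin n₀ → Input d) (a : Fin m → ℝ) (r : Fin m) :
    EuclideanSpace ℝ (Fin D) :=
  WithLp.toLp 2 ((CFC.sqrt (empCov θ X)).mulVec fun j =>
    c (τ r) * ((D : ℝ)⁻¹ * r₁ (τ r) (θ j))
      + a r * (c (τ r) * (α (τ r) * ((D : ℝ)⁻¹ * r₂ (τ r) (θ j)))))

theorem quadNTK_starWeights {d D n₀ m k : ℕ}
    (r₁ r₂ : Fin k → EuclideanSpace ℝ (Fin d) × ℝ → ℝ) (α c : Fin k → ℝ) (τ : Fin m → Fin k)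
    {ω : Outcome d D n₀ m} (h : (empCov ω.1 ω.2.1).PosDef) (x : Input d) :
    quadNTK ω.2.2.1 ω.2.2.2 (starWeights r₁ r₂ α c τ ω.1 ω.2.1 ω.2.2.1) (whitened ω.1 ω.2.1 x)
      = readoutModel r₁ r₂ α c τ ω x := by
  unfold quadNTK readoutModel
  rw [rep_eq_whitened h]
  congr 1
  refine Finset.sum_congr rfl fun r _ => ?_
  unfold starWeights
  rw [inner_sqrt_mulVec_whitened h]
  have e : ∑ j, (c (τ r) * ((D : ℝ)⁻¹ * r₁ (τ r) (ω.1 j))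
      + ω.2.2.1 r * (c (τ r) * (α (τ r) * ((D : ℝ)⁻¹ * r₂ (τ r) (ω.1 j))))) * feature ω.1 x j
      = c (τ r) * readout (r₁ (τ r)) ω.1 x
        + ω.2.2.1 r * (c (τ r) * (α (τ r) * readout (r₂ (τ r)) ω.1 x)) := by
    unfold readout
    simp only [Finset.mul_sum, ← Finset.sum_add_distrib]
    exact Finset.sum_congr rfl fun j _ => by ring
  rw [e]
  rfl

/-- Here `10000 = 4 * 50²`, and one summand is kept from the sum of nonnegative terms. -/
theorem ten_thousand_mul_le {d D k : ℕ} {β : Fin k → EuclideanSpace ℝ (Fin d)} {p : Fin k → ℕ}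
    {ε δ c : ℝ} (hε : 0 < ε) (hδ : 0 < δ) (hc : 4 ≤ c)
    (hD : c * 50 ^ 2 * (k : ℝ) ^ 3 *
        (∑ s, ((max (p s) 1 : ℕ) : ℝ) ^ 5 * ‖β s‖ ^ (2 * ⌈(p s : ℝ) / 2⌉₊)) / (ε ^ 2 * δ)
      ≤ (D : ℝ)) (s : Fin k) :
    10000 * (k : ℝ) ^ 3 * (((max (p s) 1 : ℕ) : ℝ) ^ 5 * ‖β s‖ ^ (2 * ((p s + 1) / 2)))
      ≤ ε ^ 2 * δ * D := by
  rw [div_le_iff₀ (by positivity)] at hD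
  simp only [ceil_half] at hD
  have h1 := Finset.single_le_sum (f := fun s => ((max (p s) 1 : ℕ) : ℝ) ^ 5 *
    ‖β s‖ ^ (2 * ((p s + 1) / 2))) (fun s _ => by positivity) (Finset.mem_univ s)
  calc _ ≤ c * 50 ^ 2 * (k : ℝ) ^ 3 * ∑ s, ((max (p s) 1 : ℕ) : ℝ) ^ 5 *
        ‖β s‖ ^ (2 * ((p s + 1) / 2)) := by
        refine mul_le_mul ?_ h1 (by positivity) (by positivity)
        refine mul_le_mul_of_nonneg_right ?_ (by positivity)
        linarith
    _ ≤ _ := by linarith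

/-- As `1/7 < 1/e`, both `log (1/ε)` and `1 + log (8/δ)` are at least 1 and can be discarded. -/
theorem fifty_four_mul_le {D k m : ℕ} {ε δ : ℝ} (hε : 0 < ε) (hε7 : ε < 1 / 7) (hδ : 0 < δ)
    (hδ1 : δ < 1)
    (hm : 54 * (k : ℝ) * (D : ℝ) * (1 + Real.log (8 / δ)) / ε ^ 2 * Real.log (1 / ε) ≤ (m : ℝ)) :
    54 * (k : ℝ) * D ≤ ε ^ 2 * m := by
  have h1 : 0 ≤ Real.log (8 / δ) := Real.log_nonneg (by rw [le_div_iff₀ hδ]; linarith)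
  have h2 : 1 ≤ Real.log (1 / ε) := by
    rw [Real.le_log_iff_exp_le (by positivity), le_div_iff₀ hε]
    have := Real.exp_one_lt_d9
    nlinarith
  have h3 : 54 * (k : ℝ) * D / ε ^ 2 ≤ m := by
    refine le_trans ?_ hm
    calc 54 * (k : ℝ) * D / ε ^ 2 = 54 * (k : ℝ) * D * 1 / ε ^ 2 * 1 := by ring
      _ ≤ _ := by gcongr; linarith
  rw [div_le_iff₀ (by positivity)] at h3
  linarith

/-- When a term is tiny or the accuracy is coarse, the zero weights do. -/
theorem eLpNorm_target_le_of_trivial {d k : ℕ} (P : Measure (Input d)) [IsProbabilityMeasure P]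
    {α : Fin k → ℝ} {β : Fin k → EuclideanSpace ℝ (Fin d)} {p : Fin k → ℕ}
    (hα : ∀ s, |α s| ≤ 1)
    (hL2 : ∀ s, eLpNorm (fun x : Input d =>
      inner ℝ (β s) (x : EuclideanSpace ℝ (Fin d)) ^ p s) 2 P ≤ 1)
    {ε : ℝ} (hε : 0 < ε) (hε1 : ε < 1)
    (h : 1 / 7 ≤ ε ∨ ∀ s, ‖β s‖ ^ ((p s + 1) / 2) ≤ ε) :
    eLpNorm (target α β p) 2 P ≤ ENNReal.ofReal (7 * k * ε) := by
  have hk : (0 : ℝ) ≤ k := Nat.cast_nonneg k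
  rcases h with h | h
  · have e : target α β p = ∑ s, fun x : Input d =>
        α s * inner ℝ (β s) (x : EuclideanSpace ℝ (Fin d)) ^ p s := by
      ext x; simp [target]
    rw [e]
    refine (eLpNorm_sum_le (fun s _ => (measurable_const.mul
      ((measurable_inner_input (β s)).pow_const _)).aestronglyMeasurable) one_le_two).trans ?_
    calc _ ≤ ∑ _s : Fin k, (1 : ℝ≥0∞) := Finset.sum_le_sum fun s _ => by
          have h1 := eLpNorm_const_smul_le (c := α s) (f := fun x : Input d =>
            inner ℝ (β s) (x : EuclideanSpace ℝ (Fin d)) ^ p s) (p := 2) (μ := P)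
          refine h1.trans ?_
          have h2 : ‖α s‖ₑ ≤ 1 := by
            rw [← ofReal_norm, Real.norm_eq_abs]
            exact ENNReal.ofReal_le_one.2 (hα s)
          exact mul_le_one' h2 (hL2 s)
      _ = ENNReal.ofReal k := by simp
      _ ≤ _ := ENNReal.ofReal_le_ofReal (by nlinarith)
  · refine (eLpNorm_le_of_abs_le (C := k * ε) fun x => ?_).trans
      (ENNReal.ofReal_le_ofReal (by nlinarith [mul_nonneg hk hε.le]))
    unfold target
    refine (Finset.abs_sum_le_sum_abs _ _).trans
      ((Finset.sum_le_sum (g := fun _ => ε) fun s _ => ?_).trans (by simp))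
    rw [abs_mul]
    have h1 := abs_pow_le_of_pow_half_le (abs_inner_input_le (β s) x) hε1 (h s)
    calc _ ≤ 1 * ε := mul_le_mul (hα s) h1 (abs_nonneg _) zero_le_one
      _ = ε := one_mul ε

/-- Of the budget `36 = 6²`, signs and gates use 16 and the random features 20. -/
theorem error_budget_le {D k m : ℕ} {ε δ : ℝ} (hk : 0 < k) (hm : 0 < m) (hε : 0 < ε) (hδ : 0 < δ)
    (h : 54 * (k : ℝ) * D ≤ ε ^ 2 * m) :
    2 * k * (32 * k / m * (δ * D / (4 * k ^ 3)) + 2 * k * (5 * ε ^ 2 * δ / k ^ 3))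
      ≤ δ * (6 * k * ε) ^ 2 := by
  have hk1 : (1 : ℝ) ≤ k := by exact_mod_cast hk
  have hm0 : (0 : ℝ) < m := by exact_mod_cast hm
  have h1 : (D : ℝ) / m ≤ ε ^ 2 := by
    rw [div_le_iff₀ hm0]
    have : (D : ℝ) ≤ 54 * k * D := by
      have : (0 : ℝ) ≤ D := Nat.cast_nonneg D
      nlinarith
    linarith
  have e : 2 * k * (32 * k / m * (δ * D / (4 * k ^ 3)) + 2 * k * (5 * ε ^ 2 * δ / k ^ 3))
      = (16 * δ * (D / m) + 20 * δ * ε ^ 2) / (k : ℝ) := by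
    field_simp; ring
  rw [e]
  calc (16 * δ * (D / m) + 20 * δ * ε ^ 2) / (k : ℝ) ≤ (16 * δ * ε ^ 2 + 20 * δ * ε ^ 2) / 1 := by
        gcongr
    _ = δ * (36 * ε ^ 2) := by ring
    _ ≤ δ * (36 * ε ^ 2 * k ^ 2) := by
        exact mul_le_mul_of_nonneg_left
          (le_mul_of_one_le_right (by positivity) (one_le_pow₀ hk1)) hδ.le
    _ = _ := by ring

end QuadNTK

/-! ### Conclusion by Markov's inequality -/

theorem mainTheorem4 (d D n₀ m k : ℕ)
    (P : Measure (QuadNTK.Input d)) [IsProbabilityMeasure P]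
    (α : Fin k → ℝ) (β : Fin k → EuclideanSpace ℝ (Fin d)) (p : Fin k → ℕ)
    (hα : ∀ s, |α s| ≤ 1)
    (hL2 : ∀ s, eLpNorm (fun x : QuadNTK.Input d =>
      (inner ℝ (β s) (x : EuclideanSpace ℝ (Fin d))) ^ p s) 2 P ≤ 1)
    (ε δ : ℝ) (hε : 0 < ε) (hε1 : ε < 1) (hδ : 0 < δ) (hδ1 : δ < 1)
    (c : ℝ) (hc : c = 8 ∨ (c = 4 ∧ ∀ s, Even (p s)))
    (hD : c * 50 ^ 2 * (k : ℝ) ^ 3 *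
        (∑ s, ((max (p s) 1 : ℕ) : ℝ) ^ 5 * ‖β s‖ ^ (2 * ⌈(p s : ℝ) / 2⌉₊)) / (ε ^ 2 * δ)
      ≤ (D : ℝ))
    (hm : 54 * (k : ℝ) * (D : ℝ) * (1 + Real.log (8 / δ)) / ε ^ 2 * Real.log (1 / ε)
      ≤ (m : ℝ)) :
    ∃ wStar : QuadNTK.FeatParam d D → (Fin n₀ → QuadNTK.Input d) → (Fin m → ℝ) →
        Fin m → EuclideanSpace ℝ (Fin D),
      QuadNTK.jointLaw D n₀ m P
        {ω : QuadNTK.Outcome d D n₀ m |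
          (QuadNTK.empCov ω.1 ω.2.1).PosDef ∧
          ¬ eLpNorm (fun x : QuadNTK.Input d =>
              QuadNTK.quadNTK ω.2.2.1 ω.2.2.2 (wStar ω.1 ω.2.1 ω.2.2.1)
                  (QuadNTK.whitened ω.1 ω.2.1 x)
                - QuadNTK.target α β p x) 2 P
            ≤ ENNReal.ofReal (7 * (k : ℝ) * ε)}
        ≤ ENNReal.ofReal δ := by
  open QuadNTK in
  have hc4 : 4 ≤ c := by rcases hc with rfl | ⟨rfl, -⟩ <;> norm_num
  -- Zero weights settle this case, `k = 0` included. Otherwise `ε < 1/7` and some monomial is kept,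
  -- which forces `k`, `D` and `m` to be positive.
  by_cases htriv : 1 / 7 ≤ ε ∨ ∀ s, ‖β s‖ ^ ((p s + 1) / 2) ≤ ε
  · refine ⟨fun _ _ _ _ => 0, ?_⟩
    have h0 := eLpNorm_target_le_of_trivial P hα hL2 hε hε1 htriv
    rw [← eLpNorm_neg] at h0
    refine (measure_mono (t := (∅ : Set (Outcome d D n₀ m))) ?_).trans (by simp)
    rintro ω ⟨-, h⟩
    simp only [quadNTK_zero, zero_sub] at h
    exact (h h0).elim
  push Not at htriv
  obtain ⟨hε7, s₀, hs₀⟩ := htriv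
  have hk : 0 < k := Fin.pos s₀
  have hDs := ten_thousand_mul_le hε hδ hc4 hD
  have hD0 : 0 < D := by
    have h1 : 0 < ‖β s₀‖ ^ (2 * ((p s₀ + 1) / 2)) := by
      rw [mul_comm, pow_mul]
      have := hε.trans hs₀
      positivity
    have h2 : (0 : ℝ) < ((max (p s₀) 1 : ℕ) : ℝ) :=
      by exact_mod_cast lt_of_lt_of_le one_pos (le_max_right _ _)
    have h3 : (0 : ℝ) < k := by exact_mod_cast hk
    have h4 : 0 < ε ^ 2 * δ * (D : ℝ) := lt_of_lt_of_le (by positivity) (hDs s₀)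
    have h5 : (0 : ℝ) < D := pos_of_mul_pos_right h4 (by positivity)
    exact_mod_cast h5
  have hmD := fifty_four_mul_le hε hε7 hδ hδ1 hm
  have hkm : k ≤ m := by
    have h1 : (1 : ℝ) ≤ D := by exact_mod_cast hD0
    have h2 : ε ^ 2 ≤ 1 := pow_le_one₀ hε.le hε1.le
    have h3 : (0 : ℝ) ≤ k := Nat.cast_nonneg k
    have h4 : (0 : ℝ) ≤ m := Nat.cast_nonneg m
    have : (k : ℝ) ≤ m := by nlinarith
    exact_mod_cast this
  have hm0 : 0 < m := hk.trans_le hkm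
  choose r₁ r₂ hr₁ hr₂ hb₁ hb₂ hr using fun s =>
    exists_readout_product hD0 hk (β s) (p s) hε hε1 hδ hδ1 (hDs s)
  obtain ⟨τ, hτ⟩ := exists_balanced_labelling hk hkm
  obtain ⟨κ, hκ, hκ4⟩ := exists_group_scale hm0 hτ
  -- The target without its dropped monomials; it differs from the full one by at most `kε`
  -- everywhere.
  set G : Fin k → Input d → ℝ := fun s x => if ε < ‖β s‖ ^ ((p s + 1) / 2) then
    inner ℝ (β s) (x : EuclideanSpace ℝ (Fin d)) ^ p s else 0 with hG
  have hGm : ∀ s, Measurable (G s) := fun s => by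
    simp only [hG]
    split_ifs
    · exact (measurable_inner_input (β s)).pow_const _
    · exact measurable_const
  have hGe : ∀ s x, |G s x - inner ℝ (β s) (x : EuclideanSpace ℝ (Fin d)) ^ p s| ≤ ε := by
    intro s x
    simp only [hG]
    split_ifs with h
    · simpa using hε.le
    · rw [zero_sub, abs_neg]
      exact abs_pow_le_of_pow_half_le (abs_inner_input_le (β s) x) hε1 (not_lt.1 h)
  have hbias : ∀ x, |∑ s, α s * G s x - target α β p x| ≤ k * ε := fun x => by
    unfold target
    rw [← Finset.sum_sub_distrib]
    refine (Finset.abs_sum_le_sum_abs _ _).trans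
      ((Finset.sum_le_sum (g := fun _ => ε) fun s _ => ?_).trans (by simp))
    rw [← mul_sub, abs_mul]
    calc _ ≤ 1 * ε := mul_le_mul (hα s) (hGe s x) (abs_nonneg _) zero_le_one
      _ = ε := one_mul ε
  have herr := lintegral_error_le (D := D) (n₀ := n₀) P hm0 hr₁ hr₂ hb₁ hb₂ hα hκ hκ4 hGm
    (A := 5 * ε ^ 2 * δ / k ^ 3) (B := δ * D / (4 * k ^ 3)) (by positivity) (by positivity)
    (ρ := fun s x => 1 + inner ℝ (β s) (x : EuclideanSpace ℝ (Fin d)) ^ (2 * p s))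
    (fun s x => by simp only [pow_mul]; positivity)
    (fun s => (integral_one_add_pow_le P (β s) (p s) (hL2 s)).1)
    (fun s => (integral_one_add_pow_le P (β s) (p s) (hL2 s)).2)
    (fun s x => (hr s x).1) (fun s x => (hr s x).2)
  replace herr := herr.trans (ENNReal.ofReal_le_ofReal (error_budget_le hk hm0 hε hδ hmD))
  refine ⟨starWeights r₁ r₂ α κ τ, ?_⟩
  have hC : (0 : ℝ) < 6 * k * ε := by
    have : (0 : ℝ) < k := by exact_mod_cast hk
    positivity
  set Φ : Outcome d D n₀ m → ℝ≥0∞ := fun ω =>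
    ∫⁻ x, ENNReal.ofReal ((readoutModel r₁ r₂ α κ τ ω x - ∑ s, α s * G s x) ^ 2) ∂P with hΦ
  have hΦm : Measurable Φ := by
    refine Measurable.lintegral_prod_right' (f := fun z : Outcome d D n₀ m × Input d =>
      ENNReal.ofReal ((readoutModel r₁ r₂ α κ τ z.1 z.2 - ∑ s, α s * G s z.2) ^ 2)) ?_
    exact ENNReal.measurable_ofReal.comp
      (((measurable_readoutModel hr₁ hr₂ α κ τ measurable_fst measurable_snd).sub
        (Finset.measurable_sum _ fun s _ => measurable_const.mul
          ((hGm s).comp measurable_snd))).pow_const 2)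
  -- Where `Σ̂` is positive definite the model equals `readoutModel`, so an error above `7kε = 6kε +
  -- kε` forces `Φ ω ≥ (6kε)²`.
  calc _ ≤ jointLaw D n₀ m P {ω | ENNReal.ofReal ((6 * k * ε) ^ 2) ≤ Φ ω} := by
        refine measure_mono ?_
        rintro ω ⟨hpos, hbad⟩
        by_contra hlt
        refine hbad ?_
        have h1 := (eLpNorm_two_le_iff _ hC.le).2 (not_le.1 hlt).le
        have h2 := eLpNorm_le_of_abs_le (μ := P) hbias
        have hm1 : Measurable fun x => readoutModel r₁ r₂ α κ τ ω x - ∑ s, α s * G s x :=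
          (measurable_readoutModel hr₁ hr₂ α κ τ (measurable_const (a := ω)) measurable_id).sub
            (Finset.measurable_sum _ fun s _ => measurable_const.mul (hGm s))
        have hm2 : Measurable fun x => ∑ s, α s * G s x - target α β p x :=
          (Finset.measurable_sum _ fun s _ => measurable_const.mul (hGm s)).sub
            (Finset.measurable_sum _ fun s _ => measurable_const.mul
              ((measurable_inner_input (β s)).pow_const _))
        have h3 := eLpNorm_add_le (p := 2) (μ := P) hm1.aestronglyMeasurable
          hm2.aestronglyMeasurable one_le_two
        have e : (fun x => quadNTK ω.2.2.1 ω.2.2.2 (starWeights r₁ r₂ α κ τ ω.1 ω.2.1 ω.2.2.1)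
            (whitened ω.1 ω.2.1 x) - target α β p x)
            = (fun x => readoutModel r₁ r₂ α κ τ ω x - ∑ s, α s * G s x) +
              fun x => ∑ s, α s * G s x - target α β p x := by
          ext x
          rw [quadNTK_starWeights r₁ r₂ α κ τ hpos]
          simp
        rw [e]
        refine (h3.trans (add_le_add h1 h2)).trans ?_
        rw [← ENNReal.ofReal_add hC.le (by positivity)]
        exact ENNReal.ofReal_le_ofReal (by linarith)
    _ ≤ (∫⁻ ω, Φ ω ∂(jointLaw D n₀ m P)) / ENNReal.ofReal ((6 * k * ε) ^ 2) :=
        meas_ge_le_lintegral_div hΦm.aemeasurable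
          (ENNReal.ofReal_pos.2 (pow_pos hC 2)).ne' (by simp)
    _ ≤ ENNReal.ofReal δ := by
        refine ENNReal.div_le_of_le_mul (herr.trans ?_)
        rw [ENNReal.ofReal_mul hδ.le]
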